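/- Let $(M,g,J)$ be a connected Kähler manifold of real dimension four with Kähler form $\omega(X,Y)=g(X,JY)$, let $f\in C^\infty(M)$ and $\lambda\in\mathbb R$ satisfy $\mathrm{Rc}+\mathrm{Hess}\,f=\lambda g$ (a Kähler gradient Ricci soliton), and let $\mathrm S$ be the scalar curvature. Consider the system $(M,\omega,f,\mathrm S)$ with moment map $\Phi=(f,\mathrm S):M\to\mathbb R^2$, and let $\mathcal S_i$ ($i=0,1$) be the set of its singular points of rank $i$, i.e. the points at which $d\Phi$ has rank $i$. For $m\in\mathcal S_0\cup\mathcal S_1$, consider the linear combinations $h=af+b\mathrm S$, $a,b\in\mathbb R$, with $dh(m)=0$, and the linearizations $A_h\in\mathfrak{sp}(T_mM,\omega_m)$ at $m$ of their Hamiltonian vector fields $X_h$, where $\iota_{X_h}\omega=dh$. If $m\in\mathcal S_0$, let $K(m,\Phi)$ be the subalgebra of $\mathfrak{sp}(T_mM,\omega_m)\cong\mathfrak{sp}(4,\mathbb R)$ generated by the $A_h$. If $m\in\mathcal S_1$, let $K(m,\Phi)$ be the subalgebra of $\mathfrak{sp}(L^{\omega}/L)\cong\mathfrak{sp}(2,\mathbb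 R)$ generated by the operators induced by the $A_h$, where $L=\mathrm{span}\{X_f(m),X_{\mathrm S}(m)\}$ and $L^{\omega}$ is its $\omega_m$-orthogonal complement. The point $m$ is called non-degenerate if $K(m,\Phi)$ is a Cartan subalgebra, and the system is called non-degenerate if every singular point is. A point $m\in\mathcal S_0$ is of elliptic-elliptic type if $K(m,\Phi)$ contains elements with pairwise distinct complex eigenvalues and the eigenvalues of each such element form two pairs $\pm i\alpha,\ \pm i\beta$ with $\alpha,\beta>0$. Then: 1. every non-degenerate point $m\in\mathcal S_0$ is isolated in $\mathcal S_0$ (it has a neighbourhood $U$ with $U\cap\mathcal S_0=\{m\}$) and is of elliptic-elliptic type; 2. if the system $(M,\omega,f,\mathrm S)$ is non-degenerate, then $f$ is a Morse function, i.e. its Hessian is non-degenerate at every critical point of $f$. -/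

import Mathlib

open scoped Manifold ContDiff Topology

noncomputable section

namespace KahlerSoliton

/-- The model space `ℝ⁴`. -/
abbrev E4 : Type := EuclideanSpace ℝ (Fin 4)

/-! ### Riemannian geometry in coordinates

A metric on an open subset of `ℝ⁴` is given by its matrix `G y = (g_ij(y))`. -/

/-- The partial derivative `∂_i φ` at `y`. -/
def pd (i : Fin 4) (φ : E4 → ℝ) (y : E4) : ℝ :=
  fderiv ℝ φ y (EuclideanSpace.single i 1)

/-- Christoffel symbols `Γ^k_ij` of the Levi-Civita connection, `∇_{∂_i} ∂_j = Γ^k_ij ∂_k`. -/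
def christoffel (G : E4 → Matrix (Fin 4) (Fin 4) ℝ) (k i j : Fin 4) (y : E4) : ℝ :=
  (1 / 2 : ℝ) * ∑ l, (G y)⁻¹ k l *
    (pd i (fun z => G z j l) y + pd j (fun z => G z i l) y - pd l (fun z => G z i j) y)

/-- Components `R^l_ijk` of the curvature `R(X,Y) = [∇_X, ∇_Y] - ∇_[X,Y]`:
`R(∂_i, ∂_j) ∂_k = R^l_ijk ∂_l`. -/
def coordRiemann (G : E4 → Matrix (Fin 4) (Fin 4) ℝ) (l i j k : Fin 4) (y : E4) : ℝ :=
  pd i (christoffel G l j k) y - pd j (christoffel G l i k) y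
    + ∑ m, (christoffel G l i m y * christoffel G m j k y
      - christoffel G l j m y * christoffel G m i k y)

/-- Components of the Ricci tensor `Rc(X,Y) = tr (Z ↦ R(Z,X)Y)`. -/
def coordRicci (G : E4 → Matrix (Fin 4) (Fin 4) ℝ) (j k : Fin 4) (y : E4) : ℝ :=
  ∑ i, coordRiemann G i i j k y

/-- The scalar curvature, the metric trace of the Ricci tensor. -/
def coordScalar (G : E4 → Matrix (Fin 4) (Fin 4) ℝ) (y : E4) : ℝ :=
  ∑ j, ∑ k, (G y)⁻¹ j k * coordRicci G j k y

/-- Components of the Riemannian Hessian, `Hess φ(X,Y) = X(Yφ) - dφ(∇_X Y)`. -/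
def coordHess (G : E4 → Matrix (Fin 4) (Fin 4) ℝ) (φ : E4 → ℝ) (i j : Fin 4) (y : E4) : ℝ :=
  pd i (pd j φ) y - ∑ k, christoffel G k i j y * pd k φ y

/-! ### Linear symplectic algebra -/

section Algebra

variable {V : Type*} [AddCommGroup V] [Module ℝ V]

/-- The complex eigenvalues of a real endomorphism, with multiplicity. -/
def complexRoots [FiniteDimensional ℝ V] (A : Module.End ℝ V) : Multiset ℂ :=
  (A.charpoly.map (algebraMap ℝ ℂ)).roots

open Classical in
/-- A subalgebra `K` of `𝔰𝔭(V, B)` has type `(j₁, j₂, j₃)` if it contains regular elements (those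
whose eigenvalues are all distinct) and every regular element of `K` has `j₁` pairs of imaginary
eigenvalues `± iα`, `j₂` pairs of real eigenvalues `± β`, and `j₃` quadruples `± α ± iβ`.
Each pair or quadruple is counted through its unique member with `α, β > 0`. -/
def HasType [FiniteDimensional ℝ V] {B : LinearMap.BilinForm ℝ V}
    (K : LieSubalgebra ℝ (skewAdjointLieSubalgebra B)) (j₁ j₂ j₃ : ℕ) : Prop :=
  (∃ A ∈ K, (complexRoots (A : Module.End ℝ V)).Nodup) ∧
  ∀ A ∈ K, (complexRoots (A : Module.End ℝ V)).Nodup →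
    (complexRoots (A : Module.End ℝ V)).countP (fun z => z.re = 0 ∧ 0 < z.im) = j₁ ∧
    (complexRoots (A : Module.End ℝ V)).countP (fun z => 0 < z.re ∧ z.im = 0) = j₂ ∧
    (complexRoots (A : Module.End ℝ V)).countP (fun z => 0 < z.re ∧ 0 < z.im) = j₃

end Algebra

/-! ### Manifolds of real dimension four -/

section Manifold

variable {M : Type*} [TopologicalSpace M] [ChartedSpace E4 M]

/-- The coordinate vector field `∂_i` of the chart `e`, at the point with coordinates `y`. -/
def coordVec (e : OpenPartialHomeomorph M E4) (i : Fin 4) (y : E4) :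
    TangentSpace 𝓘(ℝ, E4) (e.symm y) :=
  mfderiv 𝓘(ℝ, E4) 𝓘(ℝ, E4) e.symm y (EuclideanSpace.single i (1 : ℝ) : E4)

section Kahler

variable [IsManifold 𝓘(ℝ, E4) ∞ M]

/-- A smooth Riemannian metric on `M`. -/
abbrev Metric (M : Type*) [TopologicalSpace M] [ChartedSpace E4 M] [IsManifold 𝓘(ℝ, E4) ∞ M] :=
  Bundle.ContMDiffRiemannianMetric 𝓘(ℝ, E4) ∞ E4 (fun p : M => TangentSpace 𝓘(ℝ, E4) p)

/-- The matrix `g_ij = g(∂_i, ∂_j)` of the metric in the chart `e`. -/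
def metricMatrix (g : Metric M) (e : OpenPartialHomeomorph M E4) (y : E4) :
    Matrix (Fin 4) (Fin 4) ℝ :=
  Matrix.of fun i j => g.inner (e.symm y) (coordVec e i y) (coordVec e j y)

/-- The scalar curvature `S : M → ℝ`. The value at `p` is computed in the preferred chart at `p`
(it does not depend on the chart). -/
def scalarCurvature (g : Metric M) (p : M) : ℝ :=
  coordScalar (metricMatrix g (chartAt E4 p)) (chartAt E4 p p)

/-- The Kähler form `ω(X, Y) = g(X, JY)`. -/
def kahlerForm (g : Metric M)
    (J : ∀ p : M, TangentSpace 𝓘(ℝ, E4) p →L[ℝ] TangentSpace 𝓘(ℝ, E4) p) (p : M) :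
    LinearMap.BilinForm ℝ (TangentSpace 𝓘(ℝ, E4) p) :=
  LinearMap.mk₂ ℝ (fun u v => g.inner p u (J p v))
    (by intros; simp) (by intros; simp) (by intros; simp) (by intros; simp)

/-- The component `ω_ij` of the Kähler form in the chart `e`. -/
def kahlerCoeff (g : Metric M)
    (J : ∀ p : M, TangentSpace 𝓘(ℝ, E4) p →L[ℝ] TangentSpace 𝓘(ℝ, E4) p)
    (e : OpenPartialHomeomorph M E4) (i j : Fin 4) (y : E4) : ℝ :=
  kahlerForm g J (e.symm y) (coordVec e i y) (coordVec e j y)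

/-- Multiplication by `i` on `ℂ² = ℝ⁴`, with `z₁ = x₀ + i x₁` and `z₂ = x₂ + i x₃`. -/
def stdJ (v : E4) : E4 := !₂[-v 1, v 0, -v 3, v 2]

/-- `(M, g, J)` is a Kähler manifold: `J` is a smooth almost complex structure, `g` is Hermitian,
`J` is integrable, and the Kähler form is closed. Around each point there is a
smooth chart in which `J` is multiplication by `i`; the transition functions between such charts
have complex linear derivatives, that is, they are holomorphic. -/
structure IsKahler (g : Metric M)
    (J : ∀ p : M, TangentSpace 𝓘(ℝ, E4) p →L[ℝ] TangentSpace 𝓘(ℝ, E4) p) : Prop where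
  smooth : ContMDiff 𝓘(ℝ, E4) (𝓘(ℝ, E4).prod 𝓘(ℝ, E4 →L[ℝ] E4)) ∞
    (fun p => Bundle.TotalSpace.mk' (E4 →L[ℝ] E4)
      (E := fun p : M => TangentSpace 𝓘(ℝ, E4) p →L[ℝ] TangentSpace 𝓘(ℝ, E4) p) p (J p))
  sq : ∀ (p : M) (v : TangentSpace 𝓘(ℝ, E4) p), J p (J p v) = -v
  hermitian : ∀ (p : M) (u v : TangentSpace 𝓘(ℝ, E4) p),
    g.inner p (J p u) (J p v) = g.inner p u v
  integrable : ∀ p : M, ∃ e ∈ IsManifold.maximalAtlas 𝓘(ℝ, E4) ∞ M, p ∈ e.source ∧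
    ∀ q ∈ e.source, ∀ v : TangentSpace 𝓘(ℝ, E4) q,
      mfderiv 𝓘(ℝ, E4) 𝓘(ℝ, E4) e q (J q v) = stdJ (mfderiv 𝓘(ℝ, E4) 𝓘(ℝ, E4) e q v)
  closed : ∀ e ∈ IsManifold.maximalAtlas 𝓘(ℝ, E4) ∞ M, ∀ y ∈ e.target, ∀ i j k,
    pd i (kahlerCoeff g J e j k) y + pd j (kahlerCoeff g J e k i) y
      + pd k (kahlerCoeff g J e i j) y = 0

/-- `(M, g, J, f, lam)` is a Kähler gradient Ricci soliton: `(M, g, J)` is Kähler, `f` is smooth,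
and `Rc + Hess f = lam g` (read in every smooth chart). -/
structure IsKahlerGradientRicciSoliton (g : Metric M)
    (J : ∀ p : M, TangentSpace 𝓘(ℝ, E4) p →L[ℝ] TangentSpace 𝓘(ℝ, E4) p)
    (f : M → ℝ) (lam : ℝ) : Prop where
  kahler : IsKahler g J
  smooth_potential : ContMDiff 𝓘(ℝ, E4) 𝓘(ℝ, ℝ) ∞ f
  soliton : ∀ e ∈ IsManifold.maximalAtlas 𝓘(ℝ, E4) ∞ M, ∀ y ∈ e.target, ∀ i j,
    coordRicci (metricMatrix g e) i j y + coordHess (metricMatrix g e) (f ∘ e.symm) i j y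
      = lam * metricMatrix g e y i j

/-- `f` is a Morse function: at each critical point the Hessian (the second derivative in smooth
charts around the point) is non-degenerate. -/
def IsMorse (f : M → ℝ) : Prop :=
  ContMDiff 𝓘(ℝ, E4) 𝓘(ℝ, ℝ) ∞ f ∧
  ∀ p : M, mfderiv 𝓘(ℝ, E4) 𝓘(ℝ, ℝ) f p = 0 →
    ∀ e ∈ IsManifold.maximalAtlas 𝓘(ℝ, E4) ∞ M, p ∈ e.source →
      ∀ u : E4, (∀ v : E4, fderiv ℝ (fderiv ℝ (f ∘ e.symm)) (e p) u v = 0) → u = 0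

end Kahler

/-! ### Singular points of the system `(M, Ω, F₁, F₂)`

`Ω` is the symplectic form and `(F₁, F₂)` the moment map. -/

/-- The rank at `p` of the differential of the moment map `(F₁, F₂)`. -/
def momentRank (F₁ F₂ : M → ℝ) (p : M) : ℕ :=
  Module.finrank ℝ
    (LinearMap.range (mfderiv 𝓘(ℝ, E4) 𝓘(ℝ, ℝ × ℝ) (fun q => (F₁ q, F₂ q)) p).toLinearMap)

/-- `𝒮_i`, the set of singular points of rank `i`. -/
def singularSet (F₁ F₂ : M → ℝ) (i : ℕ) : Set M :=
  {p | momentRank F₁ F₂ p = i ∧ i < 2}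

/-- `X` is the Hamiltonian vector field of `h`: `ι_X Ω = dh`. -/
def IsHamiltonianField (Ω : ∀ p : M, LinearMap.BilinForm ℝ (TangentSpace 𝓘(ℝ, E4) p))
    (h : M → ℝ) (X : ∀ p : M, TangentSpace 𝓘(ℝ, E4) p) : Prop :=
  ∀ (p : M) (v : TangentSpace 𝓘(ℝ, E4) p), Ω p (X p) v = mfderiv 𝓘(ℝ, E4) 𝓘(ℝ, ℝ) h p v

/-- The vector field `X` read in the chart `e`. -/
def chartField (X : ∀ p : M, TangentSpace 𝓘(ℝ, E4) p) (e : OpenPartialHomeomorph M E4)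
    (y : E4) : E4 :=
  mfderiv 𝓘(ℝ, E4) 𝓘(ℝ, E4) e (e.symm y) (X (e.symm y))

/-- `m` is a zero of `X` and `A : T_mM → T_mM` is the linearization of `X` at `m`: in each chart
around `m` it is the derivative at `m` of the components of `X`. -/
def IsLinearization [IsManifold 𝓘(ℝ, E4) ∞ M] (X : ∀ p : M, TangentSpace 𝓘(ℝ, E4) p) (m : M)
    (A : Module.End ℝ (TangentSpace 𝓘(ℝ, E4) m)) : Prop :=
  X m = 0 ∧ ∀ e ∈ IsManifold.maximalAtlas 𝓘(ℝ, E4) ∞ M, m ∈ e.source →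
    ∃ D : E4 →L[ℝ] E4, HasFDerivAt (chartField X e) D (e m) ∧
      ∀ v : TangentSpace 𝓘(ℝ, E4) m,
        mfderiv 𝓘(ℝ, E4) 𝓘(ℝ, E4) e m (A v) = D (mfderiv 𝓘(ℝ, E4) 𝓘(ℝ, E4) e m v)

section Singular

variable [IsManifold 𝓘(ℝ, E4) ∞ M]
  (Ω : ∀ p : M, LinearMap.BilinForm ℝ (TangentSpace 𝓘(ℝ, E4) p)) (F₁ F₂ : M → ℝ) (m : M)

/-- The linearizations `A_h` at `m` of the Hamiltonian vector fields of those linear combinations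
`h = a F₁ + b F₂` whose differential vanishes at `m`. -/
def linearizedOperators : Set (Module.End ℝ (TangentSpace 𝓘(ℝ, E4) m)) :=
  {A | ∃ (a b : ℝ) (X : ∀ p : M, TangentSpace 𝓘(ℝ, E4) p),
    IsHamiltonianField Ω (fun p => a * F₁ p + b * F₂ p) X ∧ IsLinearization X m A}

/-- The subalgebra `K(m, Φ)` of `𝔰𝔭(T_mM, Ω_m)` attached to a singular point `m` of rank `0`. -/
def algebraK : LieSubalgebra ℝ (skewAdjointLieSubalgebra (Ω m)) :=
  LieSubalgebra.lieSpan ℝ _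
    {A | (A : Module.End ℝ (TangentSpace 𝓘(ℝ, E4) m)) ∈ linearizedOperators Ω F₁ F₂ m}

/-- The span `L ⊆ T_mM` of the values at `m` of the Hamiltonian vector fields of `F₁` and `F₂`. -/
def hamiltonianSpan : Submodule ℝ (TangentSpace 𝓘(ℝ, E4) m) :=
  Submodule.span ℝ
    {v | (∀ w, Ω m v w = mfderiv 𝓘(ℝ, E4) 𝓘(ℝ, ℝ) F₁ m w) ∨
      (∀ w, Ω m v w = mfderiv 𝓘(ℝ, E4) 𝓘(ℝ, ℝ) F₂ m w)}

/-- The skew-orthogonal complement `L'` of `L` in `T_mM`. -/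
def skewComplement : Submodule ℝ (TangentSpace 𝓘(ℝ, E4) m) :=
  (Ω m).orthogonal (hamiltonianSpan Ω F₁ F₂ m)

/-- The reduced symplectic space `L' / L`. -/
abbrev ReducedSpace : Type :=
  skewComplement Ω F₁ F₂ m ⧸
    (hamiltonianSpan Ω F₁ F₂ m).comap (skewComplement Ω F₁ F₂ m).subtype

/-- A singular point of rank `0` is non-degenerate if `K(m, Φ)` is a Cartan subalgebra of
`𝔰𝔭(T_mM, Ω_m) ≅ 𝔰𝔭(4, ℝ)`. -/
def IsNondegenerateRankZero : Prop :=
  (algebraK Ω F₁ F₂ m).IsCartanSubalgebra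

/-- A singular point of rank `1` is non-degenerate if the subalgebra generated by the operators
that the linearizations `A_h` induce on the symplectic plane `L' / L` is a Cartan subalgebra of
`𝔰𝔭(L' / L, B) ≅ 𝔰𝔭(2, ℝ)`, where `B` is the form induced by `Ω_m`. -/
def IsNondegenerateRankOne : Prop :=
  ∃ B : LinearMap.BilinForm ℝ (ReducedSpace Ω F₁ F₂ m),
    (∀ x y : skewComplement Ω F₁ F₂ m,
      B (Submodule.Quotient.mk x) (Submodule.Quotient.mk y) = Ω m x y) ∧
    (LieSubalgebra.lieSpan ℝ (skewAdjointLieSubalgebra B)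
      {T | ∃ A ∈ linearizedOperators Ω F₁ F₂ m, ∀ x : skewComplement Ω F₁ F₂ m,
        ∃ hx : A x ∈ skewComplement Ω F₁ F₂ m,
          (T : Module.End ℝ (ReducedSpace Ω F₁ F₂ m)) (Submodule.Quotient.mk x)
            = Submodule.Quotient.mk ⟨A x, hx⟩}).IsCartanSubalgebra

/-- A rank `0` singular point is of elliptic-elliptic type if `K(m, Φ)` has type `(2, 0, 0)`. -/
def IsEllipticElliptic [FiniteDimensional ℝ (TangentSpace 𝓘(ℝ, E4) m)] : Prop :=
  HasType (algebraK Ω F₁ F₂ m) 2 0 0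

/-- The system is non-degenerate if each of its singular points is non-degenerate. -/
def IsNondegenerateSystem : Prop :=
  (∀ p ∈ singularSet F₁ F₂ 0, IsNondegenerateRankZero Ω F₁ F₂ p) ∧
  (∀ p ∈ singularSet F₁ F₂ 1, IsNondegenerateRankOne Ω F₁ F₂ p)

end Singular

end Manifold

instance {M : Type*} [TopologicalSpace M] [ChartedSpace E4 M] (m : M) :
    FiniteDimensional ℝ (TangentSpace 𝓘(ℝ, E4) m) :=
  inferInstanceAs (FiniteDimensional ℝ E4)

end KahlerSoliton

end

open KahlerSoliton

namespace KahlerSoliton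

/-! ### Calculus of partial derivatives on open subsets of `ℝ⁴` -/

/-! Write H for the Hessian of f as an endomorphism, so that Rc = λ - H. A Kähler metric has
J-invariant Ricci tensor, hence on a soliton H commutes with J, besides being self-adjoint
(`IsLocalSoliton.covMat_mul`). The identity dS = 2 Rc(∇f) (`IsLocalSoliton.pd_coordScalar`) then
gives ∇S = 2(λ - H)∇f. So every critical point of f is critical for S, the points of rank zero are
exactly the critical points of f, and there the field X_h of h = af + bS, which equals J∇h,
linearizes to J(a + 2b(λ - H))H (`IsLocalSoliton.vecPd_hamField`).

The rest is linear algebra (`injective_and_hasType_of_isCartanSubalgebra`). These operators commute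
with one another, so the algebra K they generate is abelian and all its elements have this form. A
symplectic operator that commutes with J and H commutes with K, hence normalizes K, hence lies in K,
because Cartan subalgebras are self-normalizing. Applied to J, this gives J = J(a + b(λ - H))H for
some a, b, so H is injective. Applied to JP, with P the projection onto the complex line of an
eigenvector of H, it gives a regular element J + JP of K. Elements of K commute with J and P, so
they act as infinitesimal rotations on two orthogonal complex lines: their eigenvalues are purely
imaginary. Injectivity of H says that the critical point of f is non-degenerate, which yields both
isolation and the Morse property.

The identity dS = 2 Rc(∇f) is obtained by comparing the traced Ricci identity for ∇f with that for
J∇f. The local computations take place in holomorphic charts, where J is a constant matrix. Since S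
is defined through a chart that varies with the point, its chart independence is needed; the soliton
equation turns it into that of the Laplacian, as S = 4λ - Δf. -/

/-- Real `4 × 4` matrices. -/
abbrev Mat4 : Type := Matrix (Fin 4) (Fin 4) ℝ

/-- `φ` is smooth at each point of `U`. -/
def SmoothFun (U : Set E4) (φ : E4 → ℝ) : Prop := ∀ y ∈ U, ContDiffAt ℝ ∞ φ y

/-- All components of the vector-valued function `v` are smooth on `U`. -/
def SmoothVec (U : Set E4) (v : E4 → Fin 4 → ℝ) : Prop := ∀ a, SmoothFun U (fun z => v z a)

/-- All entries of the matrix-valued function `A` are smooth on `U`. -/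
def SmoothMat (U : Set E4) (A : E4 → Mat4) : Prop := ∀ a b, SmoothFun U (fun z => A z a b)

/-- Entrywise partial derivative of a matrix-valued function. -/
noncomputable def matPd (i : Fin 4) (A : E4 → Mat4) (y : E4) : Mat4 :=
  Matrix.of fun a b => pd i (fun z => A z a b) y

/-- Componentwise partial derivative of a vector-valued function. -/
noncomputable def vecPd (i : Fin 4) (v : E4 → Fin 4 → ℝ) (y : E4) : Fin 4 → ℝ :=
  fun a => pd i (fun z => v z a) y

section Calculus

variable {U : Set E4} {φ ψ : E4 → ℝ} {v w : E4 → Fin 4 → ℝ} {A B : E4 → Mat4} {y : E4}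

lemma SmoothFun.differentiableAt (h : SmoothFun U φ) (hy : y ∈ U) : DifferentiableAt ℝ φ y :=
  (h y hy).differentiableAt (by simp)

lemma SmoothFun.const (c : ℝ) : SmoothFun U (fun _ => c) := fun _ _ => contDiffAt_const

lemma SmoothFun.add (h : SmoothFun U φ) (h' : SmoothFun U ψ) :
    SmoothFun U (fun z => φ z + ψ z) := fun y hy => (h y hy).add (h' y hy)

lemma SmoothFun.sub (h : SmoothFun U φ) (h' : SmoothFun U ψ) :
    SmoothFun U (fun z => φ z - ψ z) := fun y hy => (h y hy).sub (h' y hy)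

lemma SmoothFun.mul (h : SmoothFun U φ) (h' : SmoothFun U ψ) :
    SmoothFun U (fun z => φ z * ψ z) := fun y hy => (h y hy).mul (h' y hy)

lemma SmoothFun.inv (h : SmoothFun U φ) (h0 : ∀ y ∈ U, φ y ≠ 0) :
    SmoothFun U (fun z => (φ z)⁻¹) := fun y hy => (h y hy).inv (h0 y hy)

lemma SmoothFun.sum {ι : Type*} {s : Finset ι} {φ : ι → E4 → ℝ}
    (h : ∀ i ∈ s, SmoothFun U (φ i)) : SmoothFun U (fun z => ∑ i ∈ s, φ i z) :=
  fun y hy => ContDiffAt.sum fun i hi => h i hi y hy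

lemma SmoothFun.prod {ι : Type*} {s : Finset ι} {φ : ι → E4 → ℝ}
    (h : ∀ i ∈ s, SmoothFun U (φ i)) : SmoothFun U (fun z => ∏ i ∈ s, φ i z) :=
  fun y hy => contDiffAt_prod fun i hi => h i hi y hy

lemma SmoothFun.pd (h : SmoothFun U φ) (i : Fin 4) : SmoothFun U (pd i φ) := fun y hy =>
  ((h y hy).fderiv_right (m := ∞) (by simp)).clm_apply contDiffAt_const

lemma SmoothFun.congr (hU : IsOpen U) (h : SmoothFun U φ) (e : ∀ y ∈ U, ψ y = φ y) :
    SmoothFun U ψ := fun y hy =>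
  (h y hy).congr_of_eventuallyEq (Filter.eventually_of_mem (hU.mem_nhds hy) e)

lemma pd_congr (hU : IsOpen U) (e : ∀ y ∈ U, φ y = ψ y) (i : Fin 4) (hy : y ∈ U) :
    pd i φ y = pd i ψ y := by
  rw [pd, pd, Filter.EventuallyEq.fderiv_eq (Filter.eventually_of_mem (hU.mem_nhds hy) e)]

lemma pd_const (i : Fin 4) (c : ℝ) : pd i (fun _ => c) y = 0 := by
  simp [pd]

lemma pd_add (i : Fin 4) (h : DifferentiableAt ℝ φ y) (h' : DifferentiableAt ℝ ψ y) :
    pd i (fun z => φ z + ψ z) y = pd i φ y + pd i ψ y := by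
  simp only [pd]
  rw [fderiv_fun_add h h']; rfl

lemma pd_sub (i : Fin 4) (h : DifferentiableAt ℝ φ y) (h' : DifferentiableAt ℝ ψ y) :
    pd i (fun z => φ z - ψ z) y = pd i φ y - pd i ψ y := by
  simp only [pd]
  rw [fderiv_fun_sub h h']; rfl

lemma pd_mul (i : Fin 4) (h : DifferentiableAt ℝ φ y) (h' : DifferentiableAt ℝ ψ y) :
    pd i (fun z => φ z * ψ z) y = pd i φ y * ψ y + φ y * pd i ψ y := by
  simp only [pd]
  rw [fderiv_fun_mul h h']
  simp; ring

lemma pd_sum {ι : Type*} {s : Finset ι} {φ : ι → E4 → ℝ} (i : Fin 4)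
    (h : ∀ j ∈ s, DifferentiableAt ℝ (φ j) y) :
    pd i (fun z => ∑ j ∈ s, φ j z) y = ∑ j ∈ s, pd i (φ j) y := by
  simp only [pd]
  rw [fderiv_fun_sum h, sum_apply]

lemma pd_comm (h : ContDiffAt ℝ ∞ φ y) (i j : Fin 4) : pd i (pd j φ) y = pd j (pd i φ) y := by
  have key : ∀ a b : Fin 4, pd a (pd b φ) y = fderiv ℝ (fderiv ℝ φ) y
      (EuclideanSpace.single a 1) (EuclideanSpace.single b 1) := by
    intro a b
    have hd : DifferentiableAt ℝ (fderiv ℝ φ) y :=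
      (h.fderiv_right (m := ∞) (by simp)).differentiableAt (by simp)
    change fderiv ℝ (fun z => fderiv ℝ φ z (EuclideanSpace.single b 1)) y _ = _
    rw [fderiv_clm_apply hd (differentiableAt_const _)]
    simp
  rw [key, key]
  exact (h.isSymmSndFDerivAt (by
    simp only [minSmoothness_of_isRCLikeNormedField]
    exact WithTop.coe_le_coe.2 (le_top (a := (2 : ℕ∞))))) _ _

lemma fderiv_apply_eq_sum_pd (φ : E4 → ℝ) (y u : E4) :
    fderiv ℝ φ y u = ∑ i, u i * pd i φ y := by
  conv_lhs => rw [← (EuclideanSpace.basisFun (Fin 4) ℝ).sum_repr u]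
  simp [pd]

lemma SmoothMat.const (C : Mat4) : SmoothMat U (fun _ => C) := fun _ _ => SmoothFun.const _

lemma SmoothMat.transpose (h : SmoothMat U A) : SmoothMat U (fun z => (A z).transpose) :=
  fun a b => h b a

lemma SmoothMat.sub (h : SmoothMat U A) (h' : SmoothMat U B) :
    SmoothMat U (fun z => A z - B z) := fun a b => (h a b).sub (h' a b)

lemma SmoothMat.mul (h : SmoothMat U A) (h' : SmoothMat U B) :
    SmoothMat U (fun z => A z * B z) := fun a b => by
  simp only [Matrix.mul_apply]
  exact SmoothFun.sum fun c _ => (h a c).mul (h' c b)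

lemma SmoothMat.mulVec (h : SmoothMat U A) (h' : SmoothVec U v) :
    SmoothVec U (fun z => (A z).mulVec (v z)) := fun a => by
  simp only [Matrix.mulVec, dotProduct]
  exact SmoothFun.sum fun c _ => (h a c).mul (h' c)

lemma SmoothMat.det (h : SmoothMat U A) : SmoothFun U (fun z => (A z).det) := by
  simp only [Matrix.det_apply']
  exact SmoothFun.sum fun σ _ => (SmoothFun.const _).mul (SmoothFun.prod fun i _ => h _ _)

lemma SmoothMat.inv (h : SmoothMat U A) (h0 : ∀ y ∈ U, (A y).det ≠ 0) :
    SmoothMat U (fun z => (A z)⁻¹) := fun a b => by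
  simp only [Matrix.inv_def, Ring.inverse_eq_inv', Matrix.smul_apply, smul_eq_mul,
    Matrix.adjugate_apply]
  refine (h.det.inv h0).mul (SmoothMat.det fun c d => ?_)
  simp only [Matrix.updateRow_apply]
  split_ifs
  · exact SmoothFun.const _
  · exact h c d

lemma SmoothMat.trace (h : SmoothMat U A) : SmoothFun U (fun z => (A z).trace) :=
  SmoothFun.sum fun i _ => h i i

lemma SmoothVec.vecPd (h : SmoothVec U v) (i : Fin 4) : SmoothVec U (vecPd i v) :=
  fun a => (h a).pd i

lemma matPd_congr (hU : IsOpen U) (e : ∀ y ∈ U, A y = B y) (i : Fin 4) (hy : y ∈ U) :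
    matPd i A y = matPd i B y := by
  ext a b
  exact pd_congr hU (fun z hz => by rw [e z hz]) i hy

lemma vecPd_congr (hU : IsOpen U) (e : ∀ y ∈ U, v y = w y) (i : Fin 4) (hy : y ∈ U) :
    vecPd i v y = vecPd i w y := by
  ext a
  exact pd_congr hU (fun z hz => by rw [e z hz]) i hy

lemma matPd_const (i : Fin 4) (C : Mat4) : matPd i (fun _ => C) y = 0 := by
  ext a b
  exact pd_const i _

lemma matPd_transpose (i : Fin 4) :
    matPd i (fun z => (A z).transpose) y = (matPd i A y).transpose := rfl

lemma matPd_add (h : SmoothMat U A) (h' : SmoothMat U B) (i : Fin 4) (hy : y ∈ U) :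
    matPd i (fun z => A z + B z) y = matPd i A y + matPd i B y := by
  ext a b
  exact pd_add i ((h a b).differentiableAt hy) ((h' a b).differentiableAt hy)

lemma matPd_mul (h : SmoothMat U A) (h' : SmoothMat U B) (i : Fin 4) (hy : y ∈ U) :
    matPd i (fun z => A z * B z) y = matPd i A y * B y + A y * matPd i B y := by
  ext a b
  simp only [matPd, Matrix.of_apply, Matrix.mul_apply, Matrix.add_apply]
  rw [pd_sum i fun c _ => ((h a c).mul (h' c b)).differentiableAt hy, ← Finset.sum_add_distrib]
  exact Finset.sum_congr rfl fun c _ =>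
    pd_mul i ((h a c).differentiableAt hy) ((h' c b).differentiableAt hy)

lemma matPd_comm (h : SmoothMat U A) (i j : Fin 4) (hy : y ∈ U) :
    matPd i (matPd j A) y = matPd j (matPd i A) y := by
  ext a b
  exact pd_comm (h a b y hy) i j

lemma vecPd_add (h : SmoothVec U v) (h' : SmoothVec U w) (i : Fin 4) (hy : y ∈ U) :
    vecPd i (fun z => v z + w z) y = vecPd i v y + vecPd i w y := by
  ext a
  exact pd_add i ((h a).differentiableAt hy) ((h' a).differentiableAt hy)

lemma vecPd_mulVec (h : SmoothMat U A) (h' : SmoothVec U v) (i : Fin 4) (hy : y ∈ U) :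
    vecPd i (fun z => (A z).mulVec (v z)) y
      = (matPd i A y).mulVec (v y) + (A y).mulVec (vecPd i v y) := by
  ext a
  simp only [matPd, vecPd, Matrix.of_apply, Matrix.mulVec, dotProduct, Pi.add_apply]
  rw [pd_sum i fun c _ => ((h a c).mul (h' c)).differentiableAt hy, ← Finset.sum_add_distrib]
  exact Finset.sum_congr rfl fun c _ =>
    pd_mul i ((h a c).differentiableAt hy) ((h' c).differentiableAt hy)

lemma vecPd_comm (h : SmoothVec U v) (i j : Fin 4) (hy : y ∈ U) :
    vecPd i (vecPd j v) y = vecPd j (vecPd i v) y := by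
  ext a
  exact pd_comm (h a y hy) i j

lemma pd_trace (h : SmoothMat U A) (i : Fin 4) (hy : y ∈ U) :
    pd i (fun z => (A z).trace) y = (matPd i A y).trace :=
  pd_sum i fun a _ => (h a a).differentiableAt hy

end Calculus

/-! ### Local Riemannian geometry in matrix form -/

/-- The matrix `(Γ_i)^l_k = Γ^l_ik` of the connection in the direction `∂_i`. -/
noncomputable def connMat (G : E4 → Mat4) (i : Fin 4) (y : E4) : Mat4 :=
  Matrix.of fun l k => christoffel G l i k y

/-- The curvature endomorphism `R(∂_i, ∂_j)`. -/
noncomputable def curvMat (G : E4 → Mat4) (i j : Fin 4) (y : E4) : Mat4 :=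
  matPd i (connMat G j) y - matPd j (connMat G i) y
    + (connMat G i y * connMat G j y - connMat G j y * connMat G i y)

/-- The matrix of the Ricci tensor. -/
noncomputable def ricciMat (G : E4 → Mat4) (y : E4) : Mat4 :=
  Matrix.of fun j k => coordRicci G j k y

lemma curvMat_apply (G : E4 → Mat4) (l i j k : Fin 4) (y : E4) :
    curvMat G i j y l k = coordRiemann G l i j k y := by
  simp only [curvMat, coordRiemann, Matrix.add_apply, Matrix.sub_apply, matPd, Matrix.of_apply,
    Matrix.mul_apply, connMat, Finset.sum_sub_distrib]

lemma ricciMat_apply (G : E4 → Mat4) (j k : Fin 4) (y : E4) :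
    ricciMat G y j k = ∑ i, curvMat G i j y i k := by
  simp only [ricciMat, coordRicci, curvMat_apply, Matrix.of_apply]

/-- A smooth Riemannian metric on the open set `U ⊆ ℝ⁴`. -/
structure IsLocalMetric (U : Set E4) (G : E4 → Mat4) : Prop where
  isOpen : IsOpen U
  smooth : SmoothMat U G
  symm : ∀ y ∈ U, (G y).transpose = G y
  pos : ∀ y ∈ U, ∀ u : Fin 4 → ℝ, u ≠ 0 → 0 < u ⬝ᵥ (G y).mulVec u

namespace IsLocalMetric

variable {U : Set E4} {G : E4 → Mat4} {y : E4}

lemma det_ne_zero (h : IsLocalMetric U G) : ∀ y ∈ U, (G y).det ≠ 0 := by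
  intro y hy h0
  obtain ⟨u, hu, hGu⟩ := Matrix.exists_mulVec_eq_zero_iff.2 h0
  have := h.pos y hy u hu
  rw [hGu] at this
  simp at this

lemma isUnit_det (h : IsLocalMetric U G) (hy : y ∈ U) : IsUnit (G y).det :=
  (h.det_ne_zero y hy).isUnit

lemma inv_mul (h : IsLocalMetric U G) (hy : y ∈ U) : (G y)⁻¹ * G y = 1 :=
  Matrix.nonsing_inv_mul _ (h.isUnit_det hy)

lemma mul_inv (h : IsLocalMetric U G) (hy : y ∈ U) : G y * (G y)⁻¹ = 1 :=
  Matrix.mul_nonsing_inv _ (h.isUnit_det hy)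

lemma smooth_inv (h : IsLocalMetric U G) : SmoothMat U (fun z => (G z)⁻¹) :=
  h.smooth.inv h.det_ne_zero

lemma apply_comm (h : IsLocalMetric U G) (hy : y ∈ U) (a b : Fin 4) : G y a b = G y b a := by
  conv_lhs => rw [← h.symm y hy]
  rfl

lemma pd_apply_comm (h : IsLocalMetric U G) (hy : y ∈ U) (i a b : Fin 4) :
    pd i (fun z => G z a b) y = pd i (fun z => G z b a) y :=
  pd_congr h.isOpen (fun _ hz => h.apply_comm hz a b) i hy

lemma smooth_connMat (h : IsLocalMetric U G) (i : Fin 4) : SmoothMat U (connMat G i) := by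
  intro l k
  simp only [connMat, Matrix.of_apply, christoffel]
  exact (SmoothFun.const _).mul (SmoothFun.sum fun m _ => (h.smooth_inv l m).mul
    ((((h.smooth _ _).pd _).add ((h.smooth _ _).pd _)).sub ((h.smooth _ _).pd _)))

/-- The Levi-Civita connection is torsion free. -/
lemma connMat_comm (h : IsLocalMetric U G) (hy : y ∈ U) (l i k : Fin 4) :
    connMat G i y l k = connMat G k y l i := by
  simp only [connMat, Matrix.of_apply, christoffel]
  congr 1
  refine Finset.sum_congr rfl fun m _ => ?_
  rw [h.pd_apply_comm hy m i k]
  ring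

lemma matPd_connMat_comm (h : IsLocalMetric U G) (hy : y ∈ U) (j l i k : Fin 4) :
    matPd j (connMat G i) y l k = matPd j (connMat G k) y l i :=
  pd_congr h.isOpen (fun _ hz => h.connMat_comm hz l i k) j hy

/-- The Koszul formula. -/
lemma mul_connMat_apply (h : IsLocalMetric U G) (hy : y ∈ U) (i j k : Fin 4) :
    (G y * connMat G i y) j k = (1 / 2 : ℝ) * (matPd i G y k j + matPd k G y i j
      - matPd j G y i k) := by
  have : connMat G i y = (G y)⁻¹ * Matrix.of fun l k => (1 / 2 : ℝ) * (matPd i G y k l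
      + matPd k G y i l - matPd l G y i k) := by
    ext l k
    simp only [connMat, Matrix.of_apply, christoffel, Matrix.mul_apply, matPd, Finset.mul_sum]
    exact Finset.sum_congr rfl fun m _ => by ring
  rw [this, ← mul_assoc, h.mul_inv hy, one_mul, Matrix.of_apply]

/-- The Levi-Civita connection is metric. -/
lemma matPd_eq (h : IsLocalMetric U G) (hy : y ∈ U) (i : Fin 4) :
    matPd i G y = G y * connMat G i y + (connMat G i y).transpose * G y := by
  have ht : (connMat G i y).transpose * G y = (G y * connMat G i y).transpose := by
    rw [Matrix.transpose_mul, h.symm y hy]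
  ext j k
  rw [ht, Matrix.add_apply, Matrix.transpose_apply, h.mul_connMat_apply hy,
    h.mul_connMat_apply hy]
  have h1 : matPd i G y k j = matPd i G y j k := h.pd_apply_comm hy i k j
  rw [h1]
  ring

/-- The curvature endomorphisms are skew-adjoint. -/
lemma mul_curvMat_add_transpose (h : IsLocalMetric U G) (hy : y ∈ U) (i j : Fin 4) :
    G y * curvMat G i j y + (curvMat G i j y).transpose * G y = 0 := by
  -- Skewness of curvature is the equality of mixed second derivatives of the metric, each computed
  -- by differentiating metric compatibility.
  have key : ∀ i j, matPd i (matPd j G) y =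
      (G y * connMat G i y + (connMat G i y).transpose * G y) * connMat G j y
        + G y * matPd i (connMat G j) y
        + ((matPd i (connMat G j) y).transpose * G y
        + (connMat G j y).transpose * (G y * connMat G i y + (connMat G i y).transpose * G y)) := by
    intro i j
    rw [matPd_congr h.isOpen (fun z hz => h.matPd_eq hz j) i hy,
      matPd_add (h.smooth.mul (h.smooth_connMat j)) ((h.smooth_connMat j).transpose.mul h.smooth)
        i hy, matPd_mul h.smooth (h.smooth_connMat j) i hy,
      matPd_mul (h.smooth_connMat j).transpose h.smooth i hy, matPd_transpose, h.matPd_eq hy i]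
  have hc := matPd_comm h.smooth i j hy
  rw [key, key, ← sub_eq_zero] at hc
  rw [← hc, curvMat]
  simp only [Matrix.transpose_add, Matrix.transpose_sub, Matrix.transpose_mul]
  noncomm_ring

lemma curvMat_swap (G : E4 → Mat4) (i j : Fin 4) (y : E4) :
    curvMat G i j y = - curvMat G j i y := by
  rw [curvMat, curvMat]; abel

/-- The first Bianchi identity. -/
lemma bianchi (h : IsLocalMetric U G) (hy : y ∈ U) (l i j k : Fin 4) :
    curvMat G i j y l k + curvMat G j k y l i + curvMat G k i y l j = 0 := by
  have hp : ∀ i j k, (connMat G i y * connMat G j y) l k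
      = (connMat G i y * connMat G k y) l j := by
    intro i j k
    simp only [Matrix.mul_apply]
    exact Finset.sum_congr rfl fun m _ => by rw [h.connMat_comm hy m j k]
  simp only [curvMat, Matrix.add_apply, Matrix.sub_apply]
  rw [hp i j k, hp j k i, hp k i j, h.matPd_connMat_comm hy i l j k,
    h.matPd_connMat_comm hy j l k i, h.matPd_connMat_comm hy k l i j]
  ring

/-- The lowered curvature is symmetric under exchange of the pairs of indices. -/
lemma mul_curvMat_pair_symm (h : IsLocalMetric U G) (hy : y ∈ U) (i j k l : Fin 4) :
    (G y * curvMat G i j y) l k = (G y * curvMat G l k y) i j := by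
  set K : Fin 4 → Fin 4 → Fin 4 → Fin 4 → ℝ := fun i j l k => (G y * curvMat G i j y) l k with hK
  have a1 : ∀ i j l k, K i j l k = - K j i l k := by
    intro i j l k
    simp only [hK]
    rw [curvMat_swap, mul_neg, Matrix.neg_apply]
  have a2 : ∀ i j l k, K i j l k = - K i j k l := by
    intro i j l k
    have ht := h.mul_curvMat_add_transpose hy i j
    have : (curvMat G i j y).transpose * G y = (G y * curvMat G i j y).transpose := by
      rw [Matrix.transpose_mul, h.symm y hy]
    rw [this] at ht
    have := congrFun (congrFun ht l) k
    simp only [Matrix.add_apply, Matrix.transpose_apply, Matrix.zero_apply] at this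
    simp only [hK]
    linarith
  have a3 : ∀ i j k l, K i j l k + K j k l i + K k i l j = 0 := by
    intro i j k l
    simp only [hK, Matrix.mul_apply, ← Finset.sum_add_distrib, ← mul_add]
    exact Finset.sum_eq_zero fun m _ => by rw [h.bianchi hy, mul_zero]
  change K i j l k = K l k i j
  -- The octahedron argument: the Bianchi identity at four cyclic shifts of the indices, with
  -- skewness in each pair cancelling the other terms.
  linarith [a3 i j k l, a3 j k l i, a3 k l i j, a3 l i j k, a2 i j l k, a2 j k l i, a2 k l i j,
    a2 l i j k, a1 k i l j, a2 i k l j, a1 l j i k, a2 j l i k, a1 l k i j]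

end IsLocalMetric

/-! ### Local Kähler geometry with constant complex structure -/

/-- A Kähler metric on the open set `U`, in coordinates where the complex structure is the
constant matrix `J`. -/
structure IsLocalKahler (U : Set E4) (G : E4 → Mat4) (J : Mat4) : Prop
    extends IsLocalMetric U G where
  sq : J * J = -1
  hermitian : ∀ y ∈ U, J.transpose * G y * J = G y
  closed : ∀ y ∈ U, ∀ i j k, (matPd i G y * J) j k + (matPd j G y * J) k i
    + (matPd k G y * J) i j = 0

namespace IsLocalKahler

variable {U : Set E4} {G : E4 → Mat4} {J : Mat4} {y : E4}

lemma transpose_mul_transpose (h : IsLocalKahler U G J) : J.transpose * J.transpose = -1 := by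
  rw [← Matrix.transpose_mul, h.sq]; simp

lemma transpose_mul (h : IsLocalKahler U G J) (hy : y ∈ U) :
    J.transpose * G y = - (G y * J) := by
  have := congrArg (· * J) (h.hermitian y hy)
  simp only [mul_assoc, h.sq] at this
  rw [← this]; simp

lemma transpose_mul_matPd (h : IsLocalKahler U G J) (hy : y ∈ U) (i : Fin 4) :
    J.transpose * matPd i G y = - (matPd i G y * J) := by
  have h1 : matPd i (fun z => J.transpose * G z + G z * J) y = 0 := by
    rw [matPd_congr h.isOpen (B := fun _ => 0) (fun z hz => by rw [h.transpose_mul hz]; simp) i hy,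
      matPd_const]
  rw [matPd_add ((SmoothMat.const _).mul h.smooth) (h.smooth.mul (SmoothMat.const _)) i hy,
    matPd_mul (SmoothMat.const _) h.smooth i hy, matPd_mul h.smooth (SmoothMat.const _) i hy,
    matPd_const, matPd_const] at h1
  simp only [zero_mul, mul_zero, zero_add, add_zero] at h1
  exact eq_neg_of_add_eq_zero_left h1

/-- The complex structure of a Kähler metric is parallel. -/
lemma connMat_mul (h : IsLocalKahler U G J) (hy : y ∈ U) (i : Fin 4) :
    connMat G i y * J = J * connMat G i y := by
  have hsymm : ∀ i a b, matPd i G y a b = matPd i G y b a := fun i a b => h.pd_apply_comm hy i a b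
  have hflip : ∀ i a b, (J.transpose * matPd i G y) a b = (matPd i G y * J) b a := by
    intro i a b
    simp only [Matrix.mul_apply, Matrix.transpose_apply]
    exact Finset.sum_congr rfl fun c _ => by rw [hsymm i c b]; ring
  have hskew : ∀ i a b, (matPd i G y * J) a b = - (matPd i G y * J) b a := by
    intro i a b
    rw [← hflip, h.transpose_mul_matPd hy, Matrix.neg_apply]
  have hJJ : ∀ i, J.transpose * matPd i G y * J = matPd i G y := by
    intro i
    rw [h.transpose_mul_matPd hy, neg_mul, mul_assoc, h.sq]; simp
  -- This is dω = 0 evaluated on J∂_j, ∂_i, J∂_l. Together with dω = 0 on the coordinate fields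
  -- themselves it gives ∇J = 0 through the Koszul formula.
  have hclosed : ∀ j l, -(∑ a, J a j * matPd a G y i l) + (matPd i G y * J) l j
      + ∑ b, J b l * matPd b G y i j = 0 := by
    intro j l
    have e1 : -(∑ a, J a j * matPd a G y i l)
        = ∑ a, ∑ b, J a j * J b l * (matPd a G y * J) i b := by
      rw [← Finset.sum_neg_distrib]
      refine Finset.sum_congr rfl fun a _ => ?_
      have : (matPd a G y * J * J) i l = - matPd a G y i l := by
        rw [mul_assoc, h.sq]; simp
      rw [← mul_neg, ← this, Matrix.mul_apply, Finset.mul_sum]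
      exact Finset.sum_congr rfl fun b _ => by ring
    have e2 : (matPd i G y * J) l j = ∑ a, ∑ b, J a j * J b l * (matPd i G y * J) b a := by
      have : (J.transpose * (matPd i G y * J) * J) l j = (matPd i G y * J) l j := by
        rw [← mul_assoc, hJJ i]
      rw [← this, Matrix.mul_apply]
      refine Finset.sum_congr rfl fun a _ => ?_
      rw [Matrix.mul_apply, Finset.sum_mul]
      exact Finset.sum_congr rfl fun b _ => by rw [Matrix.transpose_apply]; ring
    have e3 : ∑ b, J b l * matPd b G y i j
        = ∑ a, ∑ b, J a j * J b l * (matPd b G y * J) a i := by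
      rw [Finset.sum_comm]
      refine Finset.sum_congr rfl fun b _ => ?_
      have : (J.transpose * (matPd b G y * J)) j i = matPd b G y i j := by
        rw [← mul_assoc, hJJ b, hsymm]
      rw [← this, Matrix.mul_apply, Finset.mul_sum]
      exact Finset.sum_congr rfl fun b _ => by rw [Matrix.transpose_apply]; ring
    rw [e1, e2, e3]
    simp only [← Finset.sum_add_distrib, ← mul_add]
    refine Finset.sum_eq_zero fun a _ => Finset.sum_eq_zero fun b _ => ?_
    rw [h.closed y hy a i b, mul_zero]
  have key : G y * connMat G i y * J = - (J.transpose * (G y * connMat G i y)) := by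
    ext l j
    have e1 : (G y * connMat G i y * J) l j = (1 / 2 : ℝ) * ((matPd i G y * J) l j
        + ∑ a, J a j * matPd a G y i l - (matPd l G y * J) i j) := by
      simp only [Matrix.mul_apply (M := G y * connMat G i y), h.mul_connMat_apply hy,
        Matrix.mul_apply (N := J), ← Finset.sum_add_distrib, ← Finset.sum_sub_distrib,
        Finset.mul_sum]
      exact Finset.sum_congr rfl fun c _ => by rw [hsymm i c l]; ring
    have e2 : (J.transpose * (G y * connMat G i y)) l j = (1 / 2 : ℝ) * ((matPd i G y * J) j l
        + (matPd j G y * J) i l - ∑ b, J b l * matPd b G y i j) := by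
      simp only [Matrix.mul_apply (M := J.transpose), h.mul_connMat_apply hy,
        Matrix.mul_apply (N := J), ← Finset.sum_add_distrib, ← Finset.sum_sub_distrib,
        Finset.mul_sum, Matrix.transpose_apply]
      exact Finset.sum_congr rfl fun c _ => by ring
    rw [Matrix.neg_apply, e1, e2]
    linarith [hclosed j l, h.closed y hy j i l, hskew i l j, hskew l j i, hskew j i l]
  have : G y * (connMat G i y * J) = G y * (J * connMat G i y) := by
    rw [← mul_assoc, key, ← mul_assoc, h.transpose_mul hy, neg_mul, neg_neg, mul_assoc]
  have := congrArg ((G y)⁻¹ * ·) this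
  simpa only [← mul_assoc, h.inv_mul hy, one_mul] using this

lemma curvMat_mul (h : IsLocalKahler U G J) (hy : y ∈ U) (i j : Fin 4) :
    curvMat G i j y * J = J * curvMat G i j y := by
  have hd : ∀ i j, matPd i (connMat G j) y * J = J * matPd i (connMat G j) y := by
    intro i j
    have := matPd_congr h.isOpen (fun z hz => h.connMat_mul hz j) i hy
    rw [matPd_mul (h.smooth_connMat j) (SmoothMat.const J) i hy,
      matPd_mul (SmoothMat.const J) (h.smooth_connMat j) i hy, matPd_const] at this
    simpa using this
  have hm : ∀ i j, connMat G i y * connMat G j y * J = J * (connMat G i y * connMat G j y) := by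
    intro i j
    rw [mul_assoc, h.connMat_mul hy, ← mul_assoc, h.connMat_mul hy, mul_assoc]
  rw [curvMat, add_mul, sub_mul, sub_mul, hd, hd, hm, hm]
  noncomm_ring

/-- `R(JX, JY) = R(X, Y)`. -/
lemma sum_curvMat (h : IsLocalKahler U G J) (hy : y ∈ U) (p q a b : Fin 4) :
    ∑ i, ∑ j, J i p * J j q * curvMat G i j y a b = curvMat G p q y a b := by
  -- Each curvature endomorphism is complex linear, so the lowered curvature is J-invariant in its
  -- endomorphism pair; pair symmetry carries this invariance over to the pair of directions.
  have inv : ∀ i j, J.transpose * (G y * curvMat G i j y) * J = G y * curvMat G i j y := by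
    intro i j
    rw [mul_assoc, mul_assoc, h.curvMat_mul hy, ← mul_assoc (G y), ← mul_assoc,
      ← mul_assoc, h.hermitian y hy]
  have low : ∀ l k, ∑ i, ∑ j, J i p * J j q * (G y * curvMat G i j y) l k
      = (G y * curvMat G p q y) l k := by
    intro l k
    rw [h.mul_curvMat_pair_symm hy p q k l, ← inv l k, Matrix.mul_apply, Finset.sum_comm]
    refine Finset.sum_congr rfl fun j _ => ?_
    rw [Matrix.mul_apply, Finset.sum_mul]
    refine Finset.sum_congr rfl fun i _ => ?_
    rw [h.mul_curvMat_pair_symm hy i j k l, Matrix.transpose_apply]; ring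
  have raise : ∀ i j, curvMat G i j y a b = ∑ l, (G y)⁻¹ a l * (G y * curvMat G i j y) l b := by
    intro i j
    rw [← Matrix.mul_apply, ← mul_assoc, h.inv_mul hy, one_mul]
  rw [raise p q]
  simp only [← low, raise, Finset.mul_sum]
  symm
  rw [Finset.sum_comm]
  refine Finset.sum_congr rfl fun i _ => ?_
  rw [Finset.sum_comm]
  exact Finset.sum_congr rfl fun j _ => Finset.sum_congr rfl fun l _ => by ring

/-- The Ricci tensor of a Kähler metric is invariant under the complex structure. -/
lemma transpose_mul_ricciMat_mul (h : IsLocalKahler U G J) (hy : y ∈ U) :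
    J.transpose * ricciMat G y * J = ricciMat G y := by
  ext a b
  -- The J acting on the argument of the curvature endomorphism is moved to its value, hence under
  -- the trace to its first direction. The J on the other index of Rc then supplies the second
  -- direction for R(JX, JY) = R(X, Y).
  have e1 : ∀ j, (ricciMat G y * J) j b = ∑ i, ∑ p, J i p * curvMat G i j y p b := by
    intro j
    simp only [Matrix.mul_apply (N := J), ricciMat_apply, Finset.sum_mul]
    rw [Finset.sum_comm]
    refine Finset.sum_congr rfl fun i _ => ?_
    rw [← Matrix.mul_apply, h.curvMat_mul hy, Matrix.mul_apply]
  rw [mul_assoc, Matrix.mul_apply, ricciMat_apply]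
  simp only [e1, ← h.sum_curvMat hy _ a, Finset.mul_sum, Matrix.transpose_apply]
  rw [Finset.sum_comm]
  symm
  rw [Finset.sum_comm]
  refine Finset.sum_congr rfl fun i _ => ?_
  rw [Finset.sum_comm]
  exact Finset.sum_congr rfl fun j _ => Finset.sum_congr rfl fun p _ => by ring

end IsLocalKahler

/-! ### Covariant derivatives -/

/-- The covariant derivative `∇v` as a matrix, `∇_i v` being its `i`-th column. -/
noncomputable def covMat (G : E4 → Mat4) (v : E4 → Fin 4 → ℝ) (y : E4) : Mat4 :=
  Matrix.of fun l i => vecPd i v y l + (connMat G i y).mulVec (v y) l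

/-- The gradient of `φ`. -/
noncomputable def gradVec (G : E4 → Mat4) (φ : E4 → ℝ) (y : E4) : Fin 4 → ℝ :=
  ((G y)⁻¹).mulVec fun j => pd j φ y

/-- The Riemannian Hessian of `φ`. -/
noncomputable def hessMat (G : E4 → Mat4) (φ : E4 → ℝ) (y : E4) : Mat4 :=
  Matrix.of fun i j => coordHess G φ i j y

namespace IsLocalMetric

variable {U : Set E4} {G : E4 → Mat4} {y : E4} {φ : E4 → ℝ} {v : E4 → Fin 4 → ℝ}

lemma smooth_covMat (h : IsLocalMetric U G) (hv : SmoothVec U v) : SmoothMat U (covMat G v) :=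
  fun l i => ((hv.vecPd i) l).add (((h.smooth_connMat i).mulVec hv) l)

lemma smooth_gradVec (h : IsLocalMetric U G) (hφ : SmoothFun U φ) : SmoothVec U (gradVec G φ) :=
  h.smooth_inv.mulVec fun j => hφ.pd j

lemma mulVec_gradVec (h : IsLocalMetric U G) (hy : y ∈ U) :
    (G y).mulVec (gradVec G φ y) = fun j => pd j φ y := by
  rw [gradVec, Matrix.mulVec_mulVec, h.mul_inv hy, Matrix.one_mulVec]

lemma gradVec_eq_zero_iff (h : IsLocalMetric U G) (hy : y ∈ U) :
    gradVec G φ y = 0 ↔ ∀ j, pd j φ y = 0 := by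
  constructor
  · intro h0 j
    have := congrFun (h.mulVec_gradVec (φ := φ) hy) j
    rw [h0] at this
    simpa using this.symm
  · intro h0
    rw [gradVec, funext h0]
    exact Matrix.mulVec_zero _

lemma hessMat_transpose (h : IsLocalMetric U G) (hφ : SmoothFun U φ) (hy : y ∈ U) :
    (hessMat G φ y).transpose = hessMat G φ y := by
  ext i j
  simp only [hessMat, Matrix.transpose_apply, Matrix.of_apply, coordHess]
  rw [pd_comm (hφ y hy)]
  congr 1
  refine Finset.sum_congr rfl fun k _ => ?_
  have := h.connMat_comm hy k i j
  simp only [connMat, Matrix.of_apply] at this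
  rw [this]

/-- Differentiate G ∇φ = dφ and replace ∂G by its expression through the connection: the transposed
term, applied to the gradient, is the Christoffel correction in the Hessian. -/
lemma mul_covMat_gradVec (h : IsLocalMetric U G) (hφ : SmoothFun U φ) (hy : y ∈ U) :
    G y * covMat G (gradVec G φ) y = hessMat G φ y := by
  ext j i
  have hv := h.smooth_gradVec hφ
  have h1 := congrFun (vecPd_congr h.isOpen (fun z hz => h.mulVec_gradVec (φ := φ) hz) i hy) j
  rw [vecPd_mulVec h.smooth hv i hy, h.matPd_eq hy i, Matrix.add_mulVec, ← Matrix.mulVec_mulVec,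
    ← Matrix.mulVec_mulVec, h.mulVec_gradVec hy] at h1
  have h2 : (G y * covMat G (gradVec G φ) y) j i = ((G y).mulVec ((connMat G i y).mulVec
      (gradVec G φ y)) + (G y).mulVec (vecPd i (gradVec G φ) y)) j := by
    rw [← Matrix.mulVec_add, add_comm]
    rfl
  have h3 : ((connMat G i y).transpose.mulVec fun j => pd j φ y) j
      = ∑ k, christoffel G k i j y * pd k φ y := rfl
  rw [h2, ← congrFun (congrFun (h.hessMat_transpose hφ hy) j) i, Matrix.transpose_apply, hessMat,
    Matrix.of_apply, coordHess, ← h3]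
  simp only [Pi.add_apply, vecPd] at h1 ⊢
  linarith

/-- The traced Ricci identity. -/
lemma sum_matPd_covMat (h : IsLocalMetric U G) (hv : SmoothVec U v) (hy : y ∈ U) (j : Fin 4) :
    ∑ i, (matPd i (covMat G v) y + connMat G i y * covMat G v y) i j
      = pd j (fun z => (covMat G v z).trace) y + (connMat G j y * covMat G v y).trace
        + (ricciMat G y).mulVec (v y) j := by
  -- These are second covariant derivatives without the term -Γ^k_ij ∇_k v. That term is symmetric
  -- in i and j, so omitting it does not affect the commutator.
  have col : ∀ i j, (fun l => (matPd i (covMat G v) y + connMat G i y * covMat G v y) l j)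
      = vecPd i (vecPd j v) y + (matPd i (connMat G j) y).mulVec (v y)
        + (connMat G j y).mulVec (vecPd i v y) + (connMat G i y).mulVec (vecPd j v y)
        + (connMat G i y * connMat G j y).mulVec (v y) := by
    intro i j
    have e1 : (fun l => matPd i (covMat G v) y l j)
        = vecPd i (fun z => vecPd j v z + (connMat G j z).mulVec (v z)) y := rfl
    have e2 : (fun l => (connMat G i y * covMat G v y) l j)
        = (connMat G i y).mulVec (vecPd j v y + (connMat G j y).mulVec (v y)) := rfl
    have e3 : (fun l => (matPd i (covMat G v) y + connMat G i y * covMat G v y) l j)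
      = (fun l => matPd i (covMat G v) y l j) + fun l => (connMat G i y * covMat G v y) l j := rfl
    rw [e3, e1, e2, vecPd_add (hv.vecPd j) ((h.smooth_connMat j).mulVec hv) i hy,
      vecPd_mulVec (h.smooth_connMat j) hv i hy, Matrix.mulVec_add, Matrix.mulVec_mulVec]
    abel
  have swap : ∀ i l, (matPd i (covMat G v) y + connMat G i y * covMat G v y) l j
      = (matPd j (covMat G v) y + connMat G j y * covMat G v y) l i
        + (curvMat G i j y).mulVec (v y) l := by
    intro i l
    have h1 := congrFun (col i j) l
    have h2 := congrFun (col j i) l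
    rw [vecPd_comm hv i j hy] at h1
    simp only [Pi.add_apply] at h1 h2
    simp only [curvMat, Matrix.add_mulVec, Matrix.sub_mulVec, Pi.add_apply, Pi.sub_apply]
    linarith
  simp only [swap, Finset.sum_add_distrib, Matrix.add_apply]
  rw [pd_trace (h.smooth_covMat hv) j hy]
  congr 1
  simp only [Matrix.mulVec, dotProduct, ricciMat_apply, Finset.sum_mul]
  exact Finset.sum_comm

end IsLocalMetric

/-- The trace of the soliton equation, S = 4λ - Δφ. It makes S a function of second order in φ, from
which its smoothness, its differential and its chart independence follow. -/
lemma coordScalar_eq {U : Set E4} {G : E4 → Mat4} {φ : E4 → ℝ} {lam : ℝ} {y : E4}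
    (h : IsLocalMetric U G) (hφ : SmoothFun U φ)
    (hs : ricciMat G y + hessMat G φ y = lam • G y) (hy : y ∈ U) :
    coordScalar G y = 4 * lam - (covMat G (gradVec G φ) y).trace := by
  have e1 : coordScalar G y = ((G y)⁻¹ * (ricciMat G y).transpose).trace := rfl
  have e2 : ricciMat G y = lam • G y - G y * covMat G (gradVec G φ) y := by
    rw [h.mul_covMat_gradVec hφ hy, ← hs]; abel
  have e3 : (ricciMat G y).transpose = ricciMat G y := by
    rw [e2, h.mul_covMat_gradVec hφ hy, Matrix.transpose_sub, h.hessMat_transpose hφ hy,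
      Matrix.transpose_smul, h.symm y hy]
  rw [e1, e3, e2, mul_sub, Matrix.mul_smul, ← mul_assoc, h.inv_mul hy, one_mul, Matrix.trace_sub,
    Matrix.trace_smul, Matrix.trace_one]
  simp [mul_comm]

/-! ### Local solitons: the gradient of the scalar curvature and the linearized Hamiltonian fields
-/

/-- A Kähler gradient Ricci soliton on the open set `U`, in coordinates where the complex
structure is the constant matrix `J`. -/
structure IsLocalSoliton (U : Set E4) (G : E4 → Mat4) (J : Mat4) (φ : E4 → ℝ) (lam : ℝ) : Prop
    extends IsLocalKahler U G J where
  smooth_potential : SmoothFun U φ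
  soliton : ∀ y ∈ U, ricciMat G y + hessMat G φ y = lam • G y

/-- The Hamiltonian vector field of `a φ + b S` in coordinates. -/
noncomputable def hamField (G : E4 → Mat4) (J : Mat4) (φ : E4 → ℝ) (a b : ℝ) (y : E4) :
    Fin 4 → ℝ :=
  J.mulVec (gradVec G (fun z => a * φ z + b * coordScalar G z) y)

namespace IsLocalSoliton

variable {U : Set E4} {G : E4 → Mat4} {J : Mat4} {φ : E4 → ℝ} {lam : ℝ} {y : E4}

lemma ricciMat_eq (h : IsLocalSoliton U G J φ lam) (hy : y ∈ U) :
    ricciMat G y = G y * (lam • 1 - covMat G (gradVec G φ) y) := by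
  rw [mul_sub, h.mul_covMat_gradVec h.smooth_potential hy, Matrix.mul_smul, mul_one,
    ← h.soliton y hy]
  abel

/-- The Hessian endomorphism is self-adjoint. -/
lemma transpose_covMat_mul (h : IsLocalSoliton U G J φ lam) (hy : y ∈ U) :
    (covMat G (gradVec G φ) y).transpose * G y = G y * covMat G (gradVec G φ) y := by
  have := h.hessMat_transpose h.smooth_potential hy
  rwa [← h.mul_covMat_gradVec h.smooth_potential hy, Matrix.transpose_mul, h.symm y hy] at this

/-- The Hessian endomorphism of the potential is complex linear. -/
lemma covMat_mul (h : IsLocalSoliton U G J φ lam) (hy : y ∈ U) :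
    covMat G (gradVec G φ) y * J = J * covMat G (gradVec G φ) y := by
  set H := covMat G (gradVec G φ) y
  -- By the soliton equation the Hessian is a combination of the metric and the Ricci tensor, both
  -- J-invariant.
  have h1 : J.transpose * (G y * H) * J = G y * H := by
    have e : G y * H = lam • G y - ricciMat G y := by
      rw [h.ricciMat_eq hy, mul_sub, Matrix.mul_smul, mul_one]; abel
    rw [e, mul_sub, sub_mul, h.transpose_mul_ricciMat_mul hy, Matrix.mul_smul, Matrix.smul_mul,
      h.hermitian y hy]
  rw [← mul_assoc, h.transpose_mul hy] at h1
  have h2 : G y * (J * H * J) = G y * (- H) := by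
    rw [mul_neg, ← h1]; noncomm_ring
  have h3 := congrArg ((G y)⁻¹ * ·) h2
  simp only [← mul_assoc, h.inv_mul hy, one_mul] at h3
  have h4 := congrArg (J * ·) h3
  simp only [← mul_assoc, h.sq] at h4
  rw [mul_neg] at h4
  simpa using h4

/-- J is parallel: it is constant in these coordinates and commutes with the connection matrices. -/
lemma covMat_mulVec (h : IsLocalKahler U G J) {v : E4 → Fin 4 → ℝ} (hv : SmoothVec U v)
    (hy : y ∈ U) : covMat G (fun z => J.mulVec (v z)) y = J * covMat G v y := by
  ext l i
  have e1 : covMat G (fun z => J.mulVec (v z)) y l i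
      = (vecPd i (fun z => J.mulVec (v z)) y + (connMat G i y).mulVec (J.mulVec (v y))) l := rfl
  have e2 : (J * covMat G v y) l i
      = (J.mulVec (vecPd i v y + (connMat G i y).mulVec (v y))) l := rfl
  rw [e1, e2, vecPd_mulVec (SmoothMat.const J) hv i hy, matPd_const, Matrix.mulVec_mulVec,
    h.connMat_mul hy, Matrix.mulVec_add, Matrix.mulVec_mulVec]
  simp

/-- H is self-adjoint and J is skew-adjoint, so transposition turns the trace of JH into its
negative. In other words J∇φ is divergence free. -/
lemma trace_mul_covMat (h : IsLocalSoliton U G J φ lam) (hy : y ∈ U) :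
    (J * covMat G (gradVec G φ) y).trace = 0 := by
  set H := covMat G (gradVec G φ) y
  have e1 : H.transpose = G y * H * (G y)⁻¹ := by
    rw [← h.transpose_covMat_mul hy, mul_assoc, h.mul_inv hy, mul_one]
  have e2 : J.transpose = - (G y * J * (G y)⁻¹) := by
    rw [← neg_mul, ← h.transpose_mul hy, mul_assoc, h.mul_inv hy, mul_one]
  have e3 : (J * H).trace = - (J * H).trace := by
    conv_lhs => rw [← Matrix.trace_transpose, Matrix.transpose_mul, e1, e2]
    have : G y * H * (G y)⁻¹ * -(G y * J * (G y)⁻¹)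
        = - (G y * H * ((G y)⁻¹ * G y) * J * (G y)⁻¹) := by noncomm_ring
    rw [this, h.inv_mul hy, mul_one, Matrix.trace_neg, Matrix.trace_mul_comm, ← mul_assoc,
      ← mul_assoc, h.inv_mul hy, one_mul, Matrix.trace_mul_comm]
  linarith

/-- The traced Ricci identity is applied to v = ∇φ and to Jv. Since ∇(Jv) = HJ, the left side for Jv
is J^T applied to the left side for v, that is to dΔφ + Rc(v). On the right, Jv has no divergence
and Rc(Jv) = -J^T Rc(v). Comparison gives J^T(dΔφ + 2 Rc(v)) = 0. -/
lemma sum_mul_pd_trace_covMat (h : IsLocalSoliton U G J φ lam) (hy : y ∈ U) (j : Fin 4) :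
    ∑ k, J k j * (pd k (fun z => (covMat G (gradVec G φ) z).trace) y
      + 2 * (ricciMat G y).mulVec (gradVec G φ y) k) = 0 := by
  set v := gradVec G φ with hv
  have sv : SmoothVec U v := h.smooth_gradVec h.smooth_potential
  have sJv : SmoothVec U (fun z => J.mulVec (v z)) := (SmoothMat.const J).mulVec sv
  have sH : SmoothMat U (covMat G v) := h.smooth_covMat sv
  have I1 := h.sum_matPd_covMat sv hy
  have I2 := h.sum_matPd_covMat sJv hy j
  have c : ∀ z ∈ U, covMat G (fun z => J.mulVec (v z)) z = covMat G v z * J := fun z hz => by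
    rw [covMat_mulVec h.toIsLocalKahler sv hz, h.covMat_mul hz]
  have t0 : pd j (fun z => (covMat G (fun z => J.mulVec (v z)) z).trace) y = 0 := by
    rw [pd_congr h.isOpen (ψ := fun _ => 0) (fun z hz => by
      rw [covMat_mulVec h.toIsLocalKahler sv hz, h.trace_mul_covMat hz]) j hy, pd_const]
  have lhs : ∑ i, (matPd i (covMat G (fun z => J.mulVec (v z))) y
      + connMat G i y * covMat G (fun z => J.mulVec (v z)) y) i j
      = ∑ k, J k j * ∑ i, (matPd i (covMat G v) y + connMat G i y * covMat G v y) i k := by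
    simp only [Finset.mul_sum]
    rw [Finset.sum_comm]
    refine Finset.sum_congr rfl fun i _ => ?_
    rw [matPd_congr h.isOpen c i hy, matPd_mul sH (SmoothMat.const J) i hy, matPd_const, mul_zero,
      add_zero, c y hy, ← mul_assoc, ← add_mul, Matrix.mul_apply]
    exact Finset.sum_congr rfl fun k _ => mul_comm _ _
  have conn : (connMat G j y * covMat G (fun z => J.mulVec (v z)) y).trace
      = ∑ k, J k j * (connMat G k y * covMat G v y).trace := by
    have e : connMat G j y * J = ∑ k, J k j • connMat G k y := by
      rw [h.connMat_mul hy]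
      ext l m
      have : (J * connMat G j y) l m = (connMat G m y * J) l j := by
        rw [h.connMat_mul hy, Matrix.mul_apply, Matrix.mul_apply]
        exact Finset.sum_congr rfl fun p _ => by rw [h.connMat_comm hy p j m]
      rw [this, Matrix.mul_apply, Matrix.sum_apply]
      exact Finset.sum_congr rfl fun k _ => by
        rw [Matrix.smul_apply, smul_eq_mul, h.connMat_comm hy l m k, mul_comm]
    rw [covMat_mulVec h.toIsLocalKahler sv hy, ← mul_assoc, e, Finset.sum_mul, Matrix.trace_sum]
    simp only [Matrix.smul_mul, Matrix.trace_smul, smul_eq_mul]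
  have ric : (ricciMat G y).mulVec (J.mulVec (v y)) j
      = - ∑ k, J k j * (ricciMat G y).mulVec (v y) k := by
    have : ricciMat G y * J = - (J.transpose * ricciMat G y) := by
      have := congrArg (J.transpose * ·) (h.transpose_mul_ricciMat_mul hy)
      simp only [← mul_assoc, h.transpose_mul_transpose] at this
      rw [← this]; noncomm_ring
    rw [Matrix.mulVec_mulVec, this, Matrix.neg_mulVec, ← Matrix.mulVec_mulVec]
    rfl
  rw [lhs, t0, conn, ric] at I2
  simp only [I1, mul_add, Finset.sum_add_distrib] at I2
  simp only [mul_add, Finset.sum_add_distrib, mul_left_comm _ (2 : ℝ), ← Finset.mul_sum]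
  linarith

/-- `d(Δφ) = -2 Rc(∇φ)`. -/
lemma pd_trace_covMat (h : IsLocalSoliton U G J φ lam) (hy : y ∈ U) (j : Fin 4) :
    pd j (fun z => (covMat G (gradVec G φ) z).trace) y
      = - 2 * (ricciMat G y).mulVec (gradVec G φ y) j := by
  set p : Fin 4 → ℝ := fun k => pd k (fun z => (covMat G (gradVec G φ) z).trace) y
    + 2 * (ricciMat G y).mulVec (gradVec G φ y) k with hp
  have hz : J.transpose.mulVec p = 0 := funext fun j => h.sum_mul_pd_trace_covMat hy j
  have hp0 : p = 0 := by
    have := congrArg J.transpose.mulVec hz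
    rwa [Matrix.mulVec_mulVec, h.transpose_mul_transpose, Matrix.mulVec_zero, Matrix.neg_mulVec,
      Matrix.one_mulVec, neg_eq_zero] at this
  have := congrFun hp0 j
  simp only [hp, Pi.zero_apply] at this
  linarith

lemma smooth_coordScalar (h : IsLocalSoliton U G J φ lam) : SmoothFun U (coordScalar G) :=
  ((SmoothFun.const (4 * lam)).sub
    (h.smooth_covMat (h.smooth_gradVec h.smooth_potential)).trace).congr h.isOpen
    fun y hy => coordScalar_eq h.toIsLocalMetric h.smooth_potential (h.soliton y hy) hy

/-- `dS = 2 Rc(∇φ)`. -/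
lemma pd_coordScalar (h : IsLocalSoliton U G J φ lam) (hy : y ∈ U) (j : Fin 4) :
    pd j (coordScalar G) y = 2 * (ricciMat G y).mulVec (gradVec G φ y) j := by
  rw [pd_congr h.isOpen (fun z hz => coordScalar_eq h.toIsLocalMetric h.smooth_potential
    (h.soliton z hz) hz) j hy, pd_sub j ((SmoothFun.const _).differentiableAt hy)
    ((h.smooth_covMat (h.smooth_gradVec h.smooth_potential)).trace.differentiableAt hy), pd_const,
    h.pd_trace_covMat hy]
  ring

/-- Raising the index in dS = 2 Rc(∇φ) turns Rc into the endomorphism λ - H. -/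
lemma gradVec_coordScalar (h : IsLocalSoliton U G J φ lam) (hy : y ∈ U) :
    gradVec G (coordScalar G) y
      = (2 : ℝ) • (lam • 1 - covMat G (gradVec G φ) y).mulVec (gradVec G φ y) := by
  have : (fun j => pd j (coordScalar G) y)
      = (2 : ℝ) • (ricciMat G y).mulVec (gradVec G φ y) :=
    funext fun j => h.pd_coordScalar hy j
  rw [gradVec, this, Matrix.mulVec_smul, h.ricciMat_eq hy, Matrix.mulVec_mulVec, ← mul_assoc,
    h.inv_mul hy, one_mul]

/-- This is why points of rank zero of the moment map are the same as critical points of the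
potential. -/
lemma pd_coordScalar_eq_zero (h : IsLocalSoliton U G J φ lam) (hy : y ∈ U)
    (h0 : gradVec G φ y = 0) (j : Fin 4) : pd j (coordScalar G) y = 0 := by
  rw [h.pd_coordScalar hy, h0, Matrix.mulVec_zero, Pi.zero_apply, mul_zero]

lemma vecPd_gradVec (h0 : gradVec G φ y = 0) (i l : Fin 4) :
    vecPd i (gradVec G φ) y l = covMat G (gradVec G φ) y l i := by
  simp [covMat, h0]

/-- The field is a smooth matrix applied to ∇φ. At a zero of ∇φ only the derivative of that last
factor survives in the linearization. -/
lemma hamField_eq (h : IsLocalSoliton U G J φ lam) (hy : y ∈ U) (a b : ℝ) :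
    hamField G J φ a b y = (J * (a • 1 + (2 * b) • (lam • 1 - covMat G (gradVec G φ) y))).mulVec
      (gradVec G φ y) := by
  have : gradVec G (fun z => a * φ z + b * coordScalar G z) y
      = a • gradVec G φ y + b • gradVec G (coordScalar G) y := by
    rw [gradVec, gradVec, gradVec, ← Matrix.mulVec_smul, ← Matrix.mulVec_smul, ← Matrix.mulVec_add]
    congr 1
    ext j
    have d1 := h.smooth_potential.differentiableAt hy
    have d2 := h.smooth_coordScalar.differentiableAt hy
    rw [pd_add j (d1.const_mul a) (d2.const_mul b), pd_mul j (differentiableAt_const _) d1,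
      pd_mul j (differentiableAt_const _) d2, pd_const, pd_const]
    simp
  rw [hamField, this, h.gradVec_coordScalar hy, ← Matrix.mulVec_mulVec]
  congr 1
  simp only [Matrix.add_mulVec, Matrix.smul_mulVec, Matrix.one_mulVec, smul_smul, mul_comm]

/-- The linearization of the Hamiltonian vector field of `a φ + b S` at a critical point. -/
lemma vecPd_hamField (h : IsLocalSoliton U G J φ lam) (hy : y ∈ U) (h0 : gradVec G φ y = 0)
    (a b : ℝ) (i l : Fin 4) :
    vecPd i (hamField G J φ a b) y l
      = (J * (a • 1 + (2 * b) • (lam • 1 - covMat G (gradVec G φ) y))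
        * covMat G (gradVec G φ) y) l i := by
  have sv : SmoothVec U (gradVec G φ) := h.smooth_gradVec h.smooth_potential
  have sM : SmoothMat U
      (fun z => J * (a • 1 + (2 * b) • (lam • 1 - covMat G (gradVec G φ) z))) := by
    have e : (fun z => J * (a • 1 + (2 * b) • (lam • 1 - covMat G (gradVec G φ) z)))
        = fun z => J * ((a + 2 * b * lam) • 1) - ((2 * b) • J) * covMat G (gradVec G φ) z := by
      funext z
      rw [smul_sub, mul_add, mul_sub, add_smul, mul_add, smul_smul, Matrix.smul_mul,
        Matrix.mul_smul _ (2 * b) (covMat _ _ _)]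
      abel
    rw [e]
    exact (SmoothMat.const _).sub ((SmoothMat.const _).mul (h.smooth_covMat sv))
  rw [vecPd_congr h.isOpen (fun z hz => h.hamField_eq hz a b) i hy, vecPd_mulVec sM sv i hy, h0,
    Matrix.mulVec_zero, zero_add]
  simp only [Matrix.mulVec, dotProduct, vecPd_gradVec h0]
  rfl

end IsLocalSoliton

/-! ### Invariance of the Laplacian under changes of coordinates -/

/-- Metric compatibility and vanishing torsion give Γ^i_ik = ½ tr(G⁻¹ ∂_k G). This form of the
divergence involves no individual Christoffel symbols, which makes a change of coordinates
tractable. -/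
lemma trace_covMat {U : Set E4} {G : E4 → Mat4} {y : E4} (h : IsLocalMetric U G) (hy : y ∈ U)
    (v : E4 → Fin 4 → ℝ) :
    (covMat G v y).trace = ∑ i, vecPd i v y i
      + (1 / 2 : ℝ) * ∑ k, v y k * ((G y)⁻¹ * matPd k G y).trace := by
  have e : ∀ k, (connMat G k y).trace = (1 / 2 : ℝ) * ((G y)⁻¹ * matPd k G y).trace := by
    intro k
    rw [h.matPd_eq hy, mul_add, Matrix.trace_add, ← mul_assoc, h.inv_mul hy, one_mul,
      Matrix.trace_mul_comm, mul_assoc, h.mul_inv hy, mul_one, Matrix.trace_transpose]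
    ring
  simp only [Matrix.trace, Matrix.diag, covMat, Matrix.of_apply, Finset.sum_add_distrib,
    Matrix.mulVec, dotProduct] at e ⊢
  congr 1
  rw [Finset.sum_comm, Finset.mul_sum]
  refine Finset.sum_congr rfl fun k _ => ?_
  rw [mul_left_comm, ← e k, Finset.mul_sum]
  exact Finset.sum_congr rfl fun i _ => by rw [h.connMat_comm hy i i k, mul_comm]

/-- The Jacobian matrix of a map between open subsets of `ℝ⁴`. -/
noncomputable def jacMat (τ : E4 → E4) (y : E4) : Mat4 :=
  Matrix.of fun a b => pd b (fun z => τ z a) y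

lemma jacMat_apply {τ : E4 → E4} {y : E4} (hτ : DifferentiableAt ℝ τ y) (a i : Fin 4) :
    jacMat τ y a i = fderiv ℝ τ y (EuclideanSpace.single i 1) a := by
  have : HasFDerivAt (fun z => τ z a) _ y :=
    (EuclideanSpace.proj (𝕜 := ℝ) a).hasFDerivAt.comp y hτ.hasFDerivAt
  simp only [jacMat, Matrix.of_apply, pd, this.fderiv]
  rfl

lemma pd_comp {τ : E4 → E4} {F : E4 → ℝ} {y : E4} (hF : DifferentiableAt ℝ F (τ y))
    (hτ : DifferentiableAt ℝ τ y) (i : Fin 4) :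
    pd i (fun z => F (τ z)) y = ∑ a, pd a F (τ y) * jacMat τ y a i := by
  have h1 : pd i (fun z => F (τ z)) y
      = fderiv ℝ F (τ y) (fderiv ℝ τ y (EuclideanSpace.single i 1)) := by
    rw [pd]
    have := fderiv_comp y hF hτ
    rw [show (fun z => F (τ z)) = F ∘ τ from rfl, this]
    rfl
  rw [h1, fderiv_apply_eq_sum_pd]
  exact Finset.sum_congr rfl fun a _ => by rw [jacMat_apply hτ, mul_comm]

/-- The Laplacian does not depend on the coordinates. -/
lemma trace_covMat_gradVec_comp {U V : Set E4} {G G' : E4 → Mat4} {F : E4 → ℝ} {τ : E4 → E4}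
    (h : IsLocalMetric U G) (h' : IsLocalMetric V G') (hF : SmoothFun V F)
    (hτ : ∀ z ∈ U, ContDiffAt ℝ ∞ τ z) (hUV : ∀ z ∈ U, τ z ∈ V)
    (hG : ∀ z ∈ U, G z = (jacMat τ z).transpose * G' (τ z) * jacMat τ z)
    {y : E4} (hy : y ∈ U) :
    (covMat G (gradVec G (fun z => F (τ z))) y).trace
      = (covMat G' (gradVec G' F) (τ y)).trace := by
  have dτ : ∀ z ∈ U, DifferentiableAt ℝ τ z := fun z hz => (hτ z hz).differentiableAt (by simp)
  have scomp : ∀ a, SmoothFun U (fun z => τ z a) := fun a z hz =>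
    (contDiffAt_euclidean.1 (hτ z hz)) a
  have sT : SmoothMat U (jacMat τ) := fun a b => (scomp a).pd b
  have sφ : SmoothFun U (fun z => F (τ z)) := fun z hz => (hF _ (hUV z hz)).comp z (hτ z hz)
  have sG' : SmoothMat U (fun z => G' (τ z)) := fun a b z hz =>
    (h'.smooth a b _ (hUV z hz)).comp z (hτ z hz)
  set v := gradVec G (fun z => F (τ z)) with hv
  set v' := gradVec G' F with hv'
  have sv : SmoothVec U v := h.smooth_gradVec sφ
  have sv' : SmoothVec V v' := h'.smooth_gradVec hF
  have detT : ∀ z ∈ U, IsUnit (jacMat τ z).det := fun z hz => by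
    have := h.det_ne_zero z hz
    rw [hG z hz, Matrix.det_mul] at this
    exact (right_ne_zero_of_mul this).isUnit
  have hvv : ∀ z ∈ U, v' (τ z) = (jacMat τ z).mulVec (v z) := by
    intro z hz
    have e1 : (fun j => pd j (fun z => F (τ z)) z)
        = (jacMat τ z).transpose.mulVec (fun a => pd a F (τ z)) := by
      funext j
      rw [pd_comp ((hF _ (hUV z hz)).differentiableAt (by simp)) (dτ z hz)]
      simp only [Matrix.mulVec, dotProduct, Matrix.transpose_apply]
      exact Finset.sum_congr rfl fun a _ => mul_comm _ _
    have e2 := h.mulVec_gradVec (φ := fun z => F (τ z)) hz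
    rw [e1, hG z hz, ← h'.mulVec_gradVec (hUV z hz), mul_assoc, ← Matrix.mulVec_mulVec,
      ← Matrix.mulVec_mulVec] at e2
    have e3 := Matrix.mulVec_injective_of_isUnit (by
      rw [Matrix.isUnit_iff_isUnit_det, Matrix.det_transpose]; exact detT z hz) e2
    have e4 := Matrix.mulVec_injective_of_isUnit (by
      rw [Matrix.isUnit_iff_isUnit_det]; exact h'.isUnit_det (hUV z hz)) e3
    exact e4.symm
  set T := jacMat τ y with hT
  have hTi : T * T⁻¹ = 1 := Matrix.mul_nonsing_inv _ (detT y hy)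
  have hiT : T⁻¹ * T = 1 := Matrix.nonsing_inv_mul _ (detT y hy)
  -- the divergence
  have hdiv : ∑ i, vecPd i v' (τ y) i
      = ∑ i, vecPd i v y i + ∑ k, v y k * (T⁻¹ * matPd k (jacMat τ) y).trace := by
    set D : Mat4 := Matrix.of fun l i => vecPd i v y l
    set D' : Mat4 := Matrix.of fun l i => vecPd i v' (τ y) l
    have e : D' * T = ∑ k, v y k • matPd k (jacMat τ) y + T * D := by
      ext l i
      have e1 := congrFun (vecPd_congr h.isOpen hvv i hy) l
      rw [vecPd_mulVec sT sv i hy] at e1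
      have e2 : vecPd i (fun z => v' (τ z)) y l = (D' * T) l i :=
        pd_comp ((sv' l).differentiableAt (hUV y hy)) (dτ y hy) i
      rw [← e2, e1, Pi.add_apply, Matrix.add_apply, Matrix.sum_apply]
      congr 1
      simp only [Matrix.mulVec, dotProduct, Matrix.smul_apply, smul_eq_mul]
      refine Finset.sum_congr rfl fun k _ => ?_
      rw [mul_comm]
      congr 1
      exact pd_comm (scomp l y hy) i k
    have e3 : D' = (∑ k, v y k • matPd k (jacMat τ) y) * T⁻¹ + T * D * T⁻¹ := by
      rw [← add_mul, ← e, mul_assoc, hTi, mul_one]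
    change D'.trace = D.trace + ∑ k, v y k * (T⁻¹ * matPd k (jacMat τ) y).trace
    rw [e3, Matrix.trace_add, Matrix.trace_mul_comm (T * D), ← mul_assoc, hiT, one_mul, add_comm,
      Finset.sum_mul, Matrix.trace_sum]
    congr 1
    refine Finset.sum_congr rfl fun k _ => ?_
    rw [Matrix.smul_mul, Matrix.trace_smul, Matrix.trace_mul_comm, smul_eq_mul]
  -- Half of the correction 2 tr(T⁻¹ ∂_k T) found here, contracted with v, equals the correction by
  -- which the coordinate divergences differ in `hdiv`; the two cancel in the Laplacian.
  have hGd : ∀ k, ((G y)⁻¹ * matPd k G y).trace = 2 * (T⁻¹ * matPd k (jacMat τ) y).trace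
      + ∑ a, T a k * ((G' (τ y))⁻¹ * matPd a G' (τ y)).trace := by
    intro k
    set N := matPd k (jacMat τ) y
    have e0 : matPd k (fun z => G' (τ z)) y = ∑ a, T a k • matPd a G' (τ y) := by
      ext p q
      have := pd_comp (i := k) ((h'.smooth p q).differentiableAt (hUV y hy)) (dτ y hy)
      rw [Matrix.sum_apply]
      refine this.trans (Finset.sum_congr rfl fun a _ => ?_)
      rw [mul_comm]; rfl
    set P := matPd k (fun z => G' (τ z)) y
    have e1 : matPd k G y = (N.transpose * G' (τ y) + T.transpose * P) * T
        + T.transpose * G' (τ y) * N := by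
      rw [matPd_congr h.isOpen hG k hy, matPd_mul (sT.transpose.mul sG') sT k hy,
        matPd_mul sT.transpose sG' k hy, matPd_transpose]
    have hGi := h'.mul_inv (hUV y hy)
    have hiG := h'.inv_mul (hUV y hy)
    have e2 : (G y)⁻¹ = T⁻¹ * (G' (τ y))⁻¹ * T.transpose⁻¹ := by
      rw [hG y hy, Matrix.mul_inv_rev, Matrix.mul_inv_rev, mul_assoc]
    have hTt : T.transpose⁻¹ * T.transpose = 1 := by
      rw [← Matrix.transpose_nonsing_inv, ← Matrix.transpose_mul, hTi, Matrix.transpose_one]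
    have e3 : (G y)⁻¹ * matPd k G y
        = T⁻¹ * ((G' (τ y))⁻¹ * (T.transpose⁻¹ * N.transpose) * G' (τ y)) * T
          + T⁻¹ * ((G' (τ y))⁻¹ * (T.transpose⁻¹ * T.transpose) * P) * T
          + T⁻¹ * ((G' (τ y))⁻¹ * (T.transpose⁻¹ * T.transpose) * G' (τ y)) * N := by
      rw [e1, e2]; noncomm_ring
    have c1 : ∀ X : Mat4, (T⁻¹ * X * T).trace = X.trace := fun X => by
      rw [Matrix.trace_mul_comm, ← mul_assoc, hTi, one_mul]
    have c2 : ∀ X : Mat4, ((G' (τ y))⁻¹ * X * G' (τ y)).trace = X.trace := fun X => by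
      rw [Matrix.trace_mul_comm, ← mul_assoc, hGi, one_mul]
    have c3 : (T.transpose⁻¹ * N.transpose).trace = (T⁻¹ * N).trace := by
      rw [← Matrix.transpose_nonsing_inv, ← Matrix.transpose_mul, Matrix.trace_transpose,
        Matrix.trace_mul_comm]
    rw [e3, hTt, Matrix.trace_add, Matrix.trace_add, c1, c1, c2, c3, mul_one, hiG, mul_one, e0,
      Finset.mul_sum, Matrix.trace_sum]
    simp only [Matrix.mul_smul, Matrix.trace_smul, smul_eq_mul]
    ring
  rw [trace_covMat h hy, trace_covMat h' (hUV y hy), hdiv, hvv y hy]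
  simp only [hGd, Matrix.mulVec, dotProduct, mul_add, Finset.sum_add_distrib, Finset.sum_mul,
    Finset.mul_sum]
  rw [add_assoc]
  congr 2
  · exact Finset.sum_congr rfl fun k _ => by ring
  · rw [Finset.sum_comm]
    exact Finset.sum_congr rfl fun k _ => Finset.sum_congr rfl fun a _ => by ring

/-! ### Linear algebra of Hermitian endomorphisms in real dimension four -/

section Spectrum

open Polynomial

lemma charpoly_rotations (s t : ℝ) :
    (!![0, -s, 0, 0; s, 0, 0, 0; 0, 0, 0, -t; 0, 0, t, 0] : Mat4).charpoly
      = (X ^ 2 + C (s ^ 2)) * (X ^ 2 + C (t ^ 2)) := by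
  simp [Matrix.charpoly, Matrix.charmatrix, Matrix.det_succ_row_zero, Fin.sum_univ_succ,
    Fin.succAbove]
  ring

lemma roots_rotations (s t : ℝ) :
    (((X ^ 2 + C (s ^ 2)) * (X ^ 2 + C (t ^ 2)) : ℝ[X]).map (algebraMap ℝ ℂ)).roots
      = {Complex.I * s, -(Complex.I * s), Complex.I * t, -(Complex.I * t)} := by
  rw [← Polynomial.roots_multiset_prod_X_sub_C
    {Complex.I * s, -(Complex.I * s), Complex.I * t, -(Complex.I * t)}]
  congr 1
  have h : ∀ r : ℝ, (X - C (Complex.I * r)) * (X - C (-(Complex.I * r)))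
      = X ^ 2 + C ((r : ℂ) ^ 2) := by
    intro r
    have : (r : ℂ) ^ 2 = -((Complex.I * r) * (Complex.I * r)) := by
      ring_nf; simp
    rw [this]
    simp only [C_neg, C_mul]
    ring
  simp only [Multiset.insert_eq_cons, Multiset.map_cons, Multiset.map_singleton,
    Multiset.prod_cons, Multiset.prod_singleton]
  rw [← mul_assoc, h, h]
  simp

end Spectrum

/-- The form g is made into an inner product on V, and the spectral theorem for symmetric operators
applies. -/
lemma exists_eigenvector {V : Type*} [AddCommGroup V] [Module ℝ V] [FiniteDimensional ℝ V]
    [Nontrivial V] (g : LinearMap.BilinForm ℝ V) (hsymm : ∀ u v, g u v = g v u)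
    (hpos : ∀ u, u ≠ 0 → 0 < g u u) (H : Module.End ℝ V) (hH : ∀ u v, g (H u) v = g u (H v)) :
    ∃ (α : ℝ) (e : V), e ≠ 0 ∧ H e = α • e := by
  let c : InnerProductSpace.Core ℝ V :=
    { inner := fun u v => g u v
      conj_inner_symm := fun u v => by simp [hsymm u v]
      re_inner_nonneg := fun u => by
        by_cases hu : u = 0
        · simp [hu]
        · simpa using (hpos u hu).le
      add_left := fun u v w => by simp
      smul_left := fun u v r => by simp
      definite := fun u h0 => by
        by_contra hu
        exact (hpos u hu).ne' h0 }
  let _ := c.toNormedAddCommGroup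
  let _ := InnerProductSpace.ofCore c.toCore
  have hs : LinearMap.IsSymmetric H := fun u v => hH u v
  obtain ⟨e, he⟩ := hs.hasEigenvalue_iSup_of_finiteDimensional.exists_hasEigenvector
  exact ⟨_, e, he.2, he.apply_eq_smul⟩

/-- A Hermitian structure `(g, J)` on a real vector space of dimension four. -/
structure IsHermitianPair {V : Type*} [AddCommGroup V] [Module ℝ V]
    (g : LinearMap.BilinForm ℝ V) (J : Module.End ℝ V) : Prop where
  symm : ∀ u v, g u v = g v u
  pos : ∀ u, u ≠ 0 → 0 < g u u
  sq : ∀ u, J (J u) = -u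
  hermitian : ∀ u v, g (J u) (J v) = g u v

/-- The `g`-orthogonal projection onto the complex line spanned by `e`. -/
noncomputable def lineProj {V : Type*} [AddCommGroup V] [Module ℝ V]
    (g : LinearMap.BilinForm ℝ V) (J : Module.End ℝ V) (e : V) : Module.End ℝ V :=
  (g e e)⁻¹ • ((g e).smulRight e + (g (J e)).smulRight (J e))

namespace IsHermitianPair

variable {V : Type*} [AddCommGroup V] [Module ℝ V]
  {g : LinearMap.BilinForm ℝ V} {J H : Module.End ℝ V} {e e' : V}

lemma apply_J (h : IsHermitianPair g J) (u v : V) : g u (J v) = - g (J u) v := by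
  rw [← h.hermitian u (J v), h.sq]; simp

lemma apply_J_self (h : IsHermitianPair g J) (u : V) : g u (J u) = 0 := by
  have h1 := h.apply_J u u
  rw [h.symm (J u) u] at h1
  linarith

lemma lineProj_apply (e u : V) :
    lineProj g J e u = (g e e)⁻¹ • (g e u • e + g (J e) u • J e) := rfl

lemma lineProj_J (h : IsHermitianPair g J) (u : V) :
    lineProj g J e (J u) = J (lineProj g J e u) := by
  simp only [lineProj_apply, h.hermitian, map_smul, map_add, h.sq, h.apply_J e u]
  module

/-- The complex line of an eigenvector is invariant under H, and so is its orthogonal complement,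
since H is self-adjoint. -/
lemma lineProj_comm (hH : ∀ u v, g (H u) v = g u (H v))
    (hHJ : ∀ u, H (J u) = J (H u)) {α : ℝ} (he : H e = α • e) (u : V) :
    lineProj g J e (H u) = H (lineProj g J e u) := by
  have h1 : g e (H u) = α * g e u := by rw [← hH, he]; simp
  have h2 : g (J e) (H u) = α * g (J e) u := by rw [← hH, hHJ, he]; simp
  simp only [lineProj_apply, h1, h2, map_smul, map_add, hHJ, he]
  module

lemma apply_lineProj (h : IsHermitianPair g J) (u v : V) :
    g (lineProj g J e u) v = g u (lineProj g J e v) := by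
  simp only [lineProj_apply, map_smul, map_add, LinearMap.smul_apply, LinearMap.add_apply,
    smul_eq_mul, h.symm u e, h.symm u (J e)]
  ring

lemma lineProj_self (h : IsHermitianPair g J) (he : e ≠ 0) : lineProj g J e e = e := by
  rw [lineProj_apply, h.symm (J e) e, h.apply_J_self, zero_smul, add_zero, smul_smul,
    inv_mul_cancel₀ (h.pos e he).ne', one_smul]

lemma lineProj_eq_zero (h1 : g e e' = 0) (h2 : g (J e) e' = 0) :
    lineProj g J e e' = 0 := by
  rw [lineProj_apply, h1, h2]; simp

lemma exists_orthogonal [FiniteDimensional ℝ V] (hV : Module.finrank ℝ V = 4) (u v : V) :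
    ∃ w : V, w ≠ 0 ∧ g u w = 0 ∧ g v w = 0 := by
  let L : V →ₗ[ℝ] ℝ × ℝ := (g u).prod (g v)
  have : LinearMap.ker L ≠ ⊥ := LinearMap.ker_ne_bot_of_finrank_lt (by
    rw [Module.finrank_prod, Module.finrank_self, hV]; norm_num)
  obtain ⟨w, hw, hw0⟩ := (Submodule.ne_bot_iff _).1 this
  have : (g u w, g v w) = 0 := hw
  exact ⟨w, hw0, (Prod.mk.inj this).1, (Prod.mk.inj this).2⟩

/-- The basis `e, Je, e', Je'`. -/
lemma exists_basis [FiniteDimensional ℝ V] (h : IsHermitianPair g J)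
    (hV : Module.finrank ℝ V = 4) (he : e ≠ 0) (he' : e' ≠ 0) (h1 : g e e' = 0)
    (h2 : g (J e) e' = 0) :
    ∃ b : Module.Basis (Fin 4) ℝ V, ⇑b = ![e, J e, e', J e'] := by
  have hJ0 : ∀ u, u ≠ 0 → J u ≠ 0 := fun u hu h0 => hu (by
    have := h.sq u
    rw [h0, map_zero] at this
    exact neg_eq_zero.1 this.symm)
  have h3 : g e (J e') = 0 := by rw [h.apply_J, h2, neg_zero]
  have li : LinearIndependent ℝ ![e, J e, e', J e'] := by
    refine LinearMap.linearIndependent_of_isOrthoᵢ (B := g) ?_ ?_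
    · rw [LinearMap.isOrthoᵢ_def]
      have a1 : g (J e) e = 0 := by rw [h.symm, h.apply_J_self]
      have a2 : g e' e = 0 := by rw [h.symm, h1]
      have a3 : g (J e') e = 0 := by rw [h.symm, h3]
      have a4 : g e' (J e) = 0 := by rw [h.symm, h2]
      have a5 : g (J e') e' = 0 := by rw [h.symm, h.apply_J_self]
      intro i j hij
      fin_cases i <;> fin_cases j <;> first
        | exact absurd rfl hij
        | simp [h.apply_J_self, h.hermitian, h1, h2, h3, a1, a2, a3, a4, a5]
    · intro i
      fin_cases i
      · exact (h.pos _ he).ne'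
      · exact (h.pos _ (hJ0 _ he)).ne'
      · exact (h.pos _ he').ne'
      · exact (h.pos _ (hJ0 _ he')).ne'
  exact ⟨basisOfLinearIndependentOfCardEqFinrank li (by simp [hV]), by simp⟩

end IsHermitianPair

/-- Commuting with J determines A on Je and Je', so in this basis A consists of two 2 × 2
infinitesimal rotations, with rates s and t. -/
lemma complexRoots_eq {V : Type*} [AddCommGroup V] [Module ℝ V] [FiniteDimensional ℝ V]
    {J A : Module.End ℝ V} {e e' : V} (hJ : ∀ u, J (J u) = -u) (hA : ∀ u, A (J u) = J (A u))
    (b : Module.Basis (Fin 4) ℝ V) (hb : ⇑b = ![e, J e, e', J e']) {s t : ℝ}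
    (h1 : A e = s • J e) (h2 : A e' = t • J e') :
    complexRoots A
      = {Complex.I * s, -(Complex.I * s), Complex.I * t, -(Complex.I * t)} := by
  have b0 : b 0 = e := by rw [hb]; rfl
  have b1 : b 1 = J e := by rw [hb]; rfl
  have b2 : b 2 = e' := by rw [hb]; rfl
  have b3 : b 3 = J e' := by rw [hb]; rfl
  have hm : LinearMap.toMatrix b b A
      = !![0, -s, 0, 0; s, 0, 0, 0; 0, 0, 0, -t; 0, 0, t, 0] := by
    have c0 : A (b 0) = s • b 1 := by rw [b0, b1, h1]
    have c1 : A (b 1) = -s • b 0 := by rw [b0, b1, hA, h1, map_smul, hJ]; simp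
    have c2 : A (b 2) = t • b 3 := by rw [b2, b3, h2]
    have c3 : A (b 3) = -t • b 2 := by rw [b2, b3, hA, h2, map_smul, hJ]; simp
    ext i j
    rw [LinearMap.toMatrix_apply]
    fin_cases j <;> simp only [Fin.zero_eta, Fin.mk_one, Fin.reduceFinMk, c0, c1, c2, c3] <;>
      fin_cases i <;> simp
  rw [complexRoots, ← LinearMap.charpoly_toMatrix A b, hm, charpoly_rotations, roots_rotations]

/-! ### Cartan subalgebras generated by the linearized operators -/

section Cartan

variable {V : Type*} [AddCommGroup V] [Module ℝ V] [FiniteDimensional ℝ V]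
  {g : LinearMap.BilinForm ℝ V} {J H : Module.End ℝ V} {Ω : LinearMap.BilinForm ℝ V}
  {S : Set (Module.End ℝ V)} {lam : ℝ}

/-- If the operators `J (a + b (lam - H)) H` generate a Cartan subalgebra of the symplectic
algebra, then this subalgebra is of elliptic-elliptic type and `H` is injective. -/
theorem injective_and_hasType_of_isCartanSubalgebra (hV : Module.finrank ℝ V = 4)
    (h : IsHermitianPair g J) (hΩ : ∀ u v, Ω u v = g u (J v))
    (hH : ∀ u v, g (H u) v = g u (H v)) (hHJ : ∀ u, H (J u) = J (H u))
    (hS : ∀ A ∈ S, ∃ a b : ℝ, A = J * (a • 1 + b • (lam • 1 - H)) * H)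
    (hK : (LieSubalgebra.lieSpan ℝ (skewAdjointLieSubalgebra Ω)
      {A | (A : Module.End ℝ V) ∈ S}).IsCartanSubalgebra) :
    Function.Injective H ∧ HasType (LieSubalgebra.lieSpan ℝ (skewAdjointLieSubalgebra Ω)
      {A | (A : Module.End ℝ V) ∈ S}) 2 0 0 := by
  set K := LieSubalgebra.lieSpan ℝ (skewAdjointLieSubalgebra Ω) {A | (A : Module.End ℝ V) ∈ S}
  have hcomm : Commute H J := LinearMap.ext hHJ
  have hbr : ∀ A B : skewAdjointLieSubalgebra Ω, ((⁅A, B⁆ : skewAdjointLieSubalgebra Ω) :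
    Module.End ℝ V) = (A : Module.End ℝ V) * B - B * A := fun _ _ => rfl
  have hpoly : ∀ (B : Module.End ℝ V) (a b : ℝ), Commute B J → Commute B H →
      Commute B (J * (a • 1 + b • (lam • 1 - H)) * H) := fun B a b hJ hH' =>
    (hJ.mul_right ((((Commute.one_right B).smul_right a)).add_right
      ((((Commute.one_right B).smul_right lam).sub_right hH').smul_right b))).mul_right hH'
  -- The family J(a + b(λ - H))H is linear in (a, b) and its members commute, so taking brackets
  -- adds nothing but zero.
  have hform : ∀ A ∈ K, ∃ a b : ℝ, (A : Module.End ℝ V) = J * (a • 1 + b • (lam • 1 - H)) * H := by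
    intro A hA
    induction hA using LieSubalgebra.lieSpan_induction with
    | mem A hA => exact hS _ hA
    | zero => exact ⟨0, 0, by simp⟩
    | add A B _ _ ihA ihB =>
      obtain ⟨a, b, hab⟩ := ihA
      obtain ⟨c, d, hcd⟩ := ihB
      refine ⟨a + c, b + d, ?_⟩
      change (A : Module.End ℝ V) + B = _
      rw [hab, hcd]
      simp only [add_smul]
      noncomm_ring
    | smul r A _ ihA =>
      obtain ⟨a, b, hab⟩ := ihA
      refine ⟨r * a, r * b, ?_⟩
      change r • (A : Module.End ℝ V) = _
      rw [hab]
      simp only [mul_smul, ← smul_add, mul_smul_comm, smul_mul_assoc]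
    | lie A B _ _ ihA ihB =>
      obtain ⟨a, b, hab⟩ := ihA
      obtain ⟨c, d, hcd⟩ := ihB
      refine ⟨0, 0, ?_⟩
      have hA : Commute (A : Module.End ℝ V) B := by
        rw [hcd]
        refine hpoly _ c d ?_ ?_ <;> rw [hab]
        · exact (hpoly J a b (Commute.refl J) hcomm.symm).symm
        · exact (hpoly H a b hcomm (Commute.refl H)).symm
      rw [hbr, hA.eq, sub_self]
      simp
  have hKcomm : ∀ A ∈ K, ∀ B : Module.End ℝ V, Commute B J → Commute B H →
      Commute B (A : Module.End ℝ V) := by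
    intro A hA B hJ hH'
    obtain ⟨a, b, hab⟩ := hform A hA
    rw [hab]
    exact hpoly B a b hJ hH'
  -- The only use of the Cartan property: K equals its normalizer, and anything that centralizes K
  -- normalizes it.
  have hmem : ∀ A : skewAdjointLieSubalgebra Ω, Commute (A : Module.End ℝ V) J →
      Commute (A : Module.End ℝ V) H → A ∈ K := by
    intro A hAJ hAH
    rw [← hK.self_normalizing, LieSubalgebra.mem_normalizer_iff]
    intro B hB
    have : ⁅A, B⁆ = 0 := by
      apply Subtype.ext
      rw [hbr, (hKcomm B hB _ hAJ hAH).eq, sub_self]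
      rfl
    rw [this]
    exact K.zero_mem
  have hskew : ∀ A : Module.End ℝ V, (∀ u, A (J u) = J (A u)) → (∀ u v, g (A u) v = - g u (A v)) →
      A ∈ skewAdjointLieSubalgebra Ω := by
    intro A hAJ hA
    refine (LinearMap.mem_skewAdjointSubmodule _).2 fun u v => ?_
    simp only [hΩ, Pi.neg_apply, map_neg, hA, hAJ]
  have hJK : (⟨J, hskew J (fun _ => rfl) fun u v => by rw [h.apply_J u v, neg_neg]⟩ :
      skewAdjointLieSubalgebra Ω) ∈ K := hmem _ (Commute.refl J) hcomm.symm
  have hinj : Function.Injective H := by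
    obtain ⟨a, b, hab⟩ := hform _ hJK
    -- J belongs to K, so it factors through H on the right; a kernel vector of H would be killed by
    -- the invertible J.
    refine (injective_iff_map_eq_zero H).2 fun u hu => ?_
    have hJu : J u = 0 := by
      have := LinearMap.congr_fun hab u
      rwa [Module.End.mul_apply, hu, map_zero] at this
    have := h.sq u
    rw [hJu, map_zero] at this
    exact neg_eq_zero.1 this.symm
  have : Nontrivial V := Module.nontrivial_of_finrank_pos (R := ℝ) (by omega)
  obtain ⟨α, e, he0, he⟩ := exists_eigenvector g h.symm h.pos H hH
  obtain ⟨e', he0', h1, h2⟩ := IsHermitianPair.exists_orthogonal (g := g) hV e (J e)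
  obtain ⟨b, hb⟩ := h.exists_basis hV he0 he0' h1 h2
  set P := lineProj g J e with hP
  have hPJ : Commute P J := LinearMap.ext fun u => h.lineProj_J u
  have hPH : Commute P H := LinearMap.ext fun u => IsHermitianPair.lineProj_comm hH hHJ he u
  have hPe : P e = e := h.lineProj_self he0
  have hPe' : P e' = 0 := IsHermitianPair.lineProj_eq_zero h1 h2
  -- The two complex lines are orthogonal and fill V, so commuting with P implies commuting with the
  -- projection onto the second line.
  have hPP : P + lineProj g J e' = 1 := by
    have h1' : g e' e = 0 := by rw [h.symm, h1]
    have h2' : g (J e') e = 0 := by rw [h.symm, h.apply_J, h2, neg_zero]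
    have q1 : lineProj g J e' e = 0 := IsHermitianPair.lineProj_eq_zero h1' h2'
    have q2 : lineProj g J e' e' = e' := h.lineProj_self he0'
    have r1 : P (J e) = J e := by rw [hP, h.lineProj_J, ← hP, hPe]
    have r2 : P (J e') = 0 := by rw [hP, h.lineProj_J, ← hP, hPe', map_zero]
    refine b.ext fun i => ?_
    rw [hb]
    fin_cases i <;> simp [hPe, hPe', q1, q2, r1, r2, h.lineProj_J]
  have hJPK : (⟨J * P, hskew (J * P) (fun u => by simp [hP, h.lineProj_J]) fun u v => by
      rw [Module.End.mul_apply, Module.End.mul_apply, ← neg_eq_iff_eq_neg, ← h.apply_J,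
        hP, h.apply_lineProj, h.lineProj_J]⟩ : skewAdjointLieSubalgebra Ω) ∈ K :=
    hmem _ ((Commute.refl J).mul_left hPJ) (hcomm.symm.mul_left hPH)
  -- The regular element is J + JP: it has rate 2 on the line of e and rate 1 on that of e', hence
  -- eigenvalues ±2i and ±i.
  refine ⟨hinj, ⟨_, K.add_mem hJK hJPK, ?_⟩, fun A hA hnd => ?_⟩
  · have := complexRoots_eq (A := J + J * P) (s := 2) (t := 1) h.sq (fun u => by
      simp [hP, h.lineProj_J]) b hb (by simp [hPe, two_smul]) (by simp [hPe'])
    change (complexRoots (J + J * P)).Nodup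
    rw [this]
    simp [Complex.ext_iff]
    norm_num
  · have hAJ : Commute (A : Module.End ℝ V) J := (hKcomm A hA J (Commute.refl J) hcomm.symm).symm
    have hAP : Commute (A : Module.End ℝ V) P := (hKcomm A hA P hPJ hPH).symm
    have hAP' : Commute (A : Module.End ℝ V) (lineProj g J e') := by
      rw [← sub_eq_iff_eq_add'.2 hPP.symm]
      exact (Commute.one_right _).sub_right hAP
    -- Since A commutes with J, skewness for Ω becomes skewness for g. Thus A e has no component
    -- along e, and within the complex line only the one along Je remains.
    have hAskew : ∀ u, g u ((A : Module.End ℝ V) u) = 0 := by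
      intro u
      have h3 : Ω ((A : Module.End ℝ V) u) (J u) = Ω u (-((A : Module.End ℝ V) (J u))) :=
        (LinearMap.mem_skewAdjointSubmodule _).1 A.2 u (J u)
      have h4 : (A : Module.End ℝ V) (J u) = J ((A : Module.End ℝ V) u) :=
        LinearMap.congr_fun hAJ.eq u
      rw [hΩ, hΩ, h4, map_neg, h.sq, h.sq, neg_neg, map_neg, h.symm _ u] at h3
      linarith
    have hrot : ∀ x, x ≠ 0 → Commute (A : Module.End ℝ V) (lineProj g J x) →
        ∃ s : ℝ, (A : Module.End ℝ V) x = s • J x := by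
      intro x hx hc
      refine ⟨(g x x)⁻¹ * g (J x) ((A : Module.End ℝ V) x), ?_⟩
      have : (A : Module.End ℝ V) x = lineProj g J x ((A : Module.End ℝ V) x) := by
        conv_lhs => rw [← h.lineProj_self hx]
        exact LinearMap.congr_fun hc.eq x
      conv_lhs => rw [this]
      rw [IsHermitianPair.lineProj_apply, hAskew, zero_smul, zero_add, smul_smul]
    obtain ⟨s, hs⟩ := hrot e he0 hAP
    obtain ⟨t, ht⟩ := hrot e' he0' hAP'
    have hr := complexRoots_eq h.sq (fun u => LinearMap.congr_fun hAJ.eq u) b hb hs ht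
    rw [hr] at hnd ⊢
    -- A zero rate would make 0 a double eigenvalue. For nonzero rates, each pair has exactly one
    -- member in the upper half plane, whatever the sign of the rate.
    have hs0 : s ≠ 0 := fun h0 => by simp [h0] at hnd
    have ht0 : t ≠ 0 := fun h0 => by simp [h0] at hnd
    rcases hs0.lt_or_gt with h3 | h3 <;> rcases ht0.lt_or_gt with h4 | h4 <;>
      simp [← Multiset.cons_zero, h3, h4, h3.not_gt, h4.not_gt]

end Cartan

/-! ### Charts -/

lemma apply_map_map_eq_dotProduct (B : E4 →L[ℝ] E4 →L[ℝ] ℝ) (L : E4 →L[ℝ] E4) (u v : E4) :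
    B (L u) (L v) = u.ofLp ⬝ᵥ (Matrix.of fun i j => B (L (EuclideanSpace.single i 1))
      (L (EuclideanSpace.single j 1)) : Mat4).mulVec v.ofLp := by
  conv_lhs => rw [← (EuclideanSpace.basisFun (Fin 4) ℝ).sum_repr u,
    ← (EuclideanSpace.basisFun (Fin 4) ℝ).sum_repr v]
  simp only [map_sum, map_smul, EuclideanSpace.basisFun_apply, EuclideanSpace.basisFun_repr,
    sum_apply, smul_apply, smul_eq_mul, dotProduct, Matrix.mulVec, Finset.mul_sum, Matrix.of_apply]
  rw [Finset.sum_comm]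
  exact Finset.sum_congr rfl fun i _ => Finset.sum_congr rfl fun j _ => by ring

lemma covMat_congr {U : Set E4} (hU : IsOpen U) {G : E4 → Mat4} {v w : E4 → Fin 4 → ℝ}
    (h : ∀ y ∈ U, v y = w y) {y : E4} (hy : y ∈ U) : covMat G v y = covMat G w y := by
  ext l i
  simp only [covMat, Matrix.of_apply]
  rw [vecPd_congr hU h i hy, h y hy]

lemma gradVec_congr {U : Set E4} (hU : IsOpen U) {G : E4 → Mat4} {φ ψ : E4 → ℝ}
    (h : ∀ y ∈ U, φ y = ψ y) {y : E4} (hy : y ∈ U) : gradVec G φ y = gradVec G ψ y := by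
  simp only [gradVec, pd_congr hU h _ hy]

section Charts

variable {M : Type*} [TopologicalSpace M] [ChartedSpace E4 M]
  {e e' : OpenPartialHomeomorph M E4} {p : M}

lemma chart_mdifferentiable (he : e ∈ IsManifold.maximalAtlas 𝓘(ℝ, E4) ∞ M) :
    e.MDifferentiable 𝓘(ℝ, E4) 𝓘(ℝ, E4) :=
  ⟨(contMDiffOn_of_mem_maximalAtlas he).mdifferentiableOn (by simp),
    (contMDiffOn_symm_of_mem_maximalAtlas he).mdifferentiableOn (by simp)⟩

/-- The derivative of a chart at `p`. -/
noncomputable def chartDeriv (e : OpenPartialHomeomorph M E4) (p : M) : E4 →L[ℝ] E4 :=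
  mfderiv 𝓘(ℝ, E4) 𝓘(ℝ, E4) e p

/-- The derivative of the inverse of a chart at the image of `p`. -/
noncomputable def chartDerivSymm (e : OpenPartialHomeomorph M E4) (p : M) : E4 →L[ℝ] E4 :=
  mfderiv 𝓘(ℝ, E4) 𝓘(ℝ, E4) e.symm (e p)

lemma chartDerivSymm_chartDeriv (he : e ∈ IsManifold.maximalAtlas 𝓘(ℝ, E4) ∞ M)
    (hp : p ∈ e.source) (u : E4) : chartDerivSymm e p (chartDeriv e p u) = u :=
  DFunLike.congr_fun ((chart_mdifferentiable he).symm_comp_deriv hp) u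

lemma chartDeriv_chartDerivSymm (he : e ∈ IsManifold.maximalAtlas 𝓘(ℝ, E4) ∞ M)
    (hp : p ∈ e.source) (u : E4) : chartDeriv e p (chartDerivSymm e p u) = u := by
  have h1 := DFunLike.congr_fun ((chart_mdifferentiable he).comp_symm_deriv (e.map_source hp)) u
  have h2 : chartDeriv e (e.symm (e p)) (chartDerivSymm e p u) = u := h1
  rwa [e.left_inv hp] at h2

/-- The chain rule for a function read in a chart. -/
lemma mfderiv_eq_fderiv_comp {F : Type*} [NormedAddCommGroup F] [NormedSpace ℝ F] {h : M → F}
    (he : e ∈ IsManifold.maximalAtlas 𝓘(ℝ, E4) ∞ M) (hp : p ∈ e.source)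
    (hh : MDifferentiableAt 𝓘(ℝ, E4) 𝓘(ℝ, F) h p) (u : E4) :
    (mfderiv 𝓘(ℝ, E4) 𝓘(ℝ, F) h p : E4 →L[ℝ] F) u
      = fderiv ℝ (h ∘ e.symm) (e p) (chartDeriv e p u) := by
  have hl := e.left_inv hp
  have h1 := mfderiv_comp (I := 𝓘(ℝ, E4)) (I' := 𝓘(ℝ, E4)) (I'' := 𝓘(ℝ, F)) (e p)
    (g := h) (f := e.symm) (by rwa [hl])
    ((chart_mdifferentiable he).mdifferentiableAt_symm (e.map_source hp))
  rw [mfderiv_eq_fderiv] at h1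
  have h2 : ∀ w : E4, fderiv ℝ (h ∘ e.symm) (e p) w
      = (mfderiv 𝓘(ℝ, E4) 𝓘(ℝ, F) h (e.symm (e p)) : E4 →L[ℝ] F) (chartDerivSymm e p w) :=
    fun w => DFunLike.congr_fun h1 w
  rw [h2, chartDerivSymm_chartDeriv he hp, hl]

lemma contDiffAt_transition (he : e ∈ IsManifold.maximalAtlas 𝓘(ℝ, E4) ∞ M)
    (he' : e' ∈ IsManifold.maximalAtlas 𝓘(ℝ, E4) ∞ M) {y : E4} (hy : y ∈ e.target)
    (hy' : e.symm y ∈ e'.source) : ContDiffAt ℝ ∞ (e' ∘ e.symm) y := by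
  rw [← contMDiffAt_iff_contDiffAt]
  exact (contMDiffAt_of_mem_maximalAtlas he' hy').comp y
    (contMDiffAt_symm_of_mem_maximalAtlas he hy)

lemma fderiv_transition (he : e ∈ IsManifold.maximalAtlas 𝓘(ℝ, E4) ∞ M)
    (he' : e' ∈ IsManifold.maximalAtlas 𝓘(ℝ, E4) ∞ M) (hp : p ∈ e.source) (hp' : p ∈ e'.source)
    (u : E4) :
    fderiv ℝ (e' ∘ e.symm) (e p) (chartDeriv e p u) = chartDeriv e' p u :=
  (mfderiv_eq_fderiv_comp he hp ((chart_mdifferentiable he').mdifferentiableAt hp') u).symm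

lemma smoothFun_comp_symm {f : M → ℝ} (hf : ContMDiff 𝓘(ℝ, E4) 𝓘(ℝ, ℝ) ∞ f)
    (he : e ∈ IsManifold.maximalAtlas 𝓘(ℝ, E4) ∞ M) : SmoothFun e.target (f ∘ e.symm) := by
  intro y hy
  rw [← contMDiffAt_iff_contDiffAt]
  exact hf.contMDiffAt.comp y (contMDiffAt_symm_of_mem_maximalAtlas he hy)

variable {J : ∀ p : M, TangentSpace 𝓘(ℝ, E4) p →L[ℝ] TangentSpace 𝓘(ℝ, E4) p}

/-- `e` is a smooth chart in which `J` is multiplication by `i`. -/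
structure IsHolomorphicChart
    (J : ∀ p : M, TangentSpace 𝓘(ℝ, E4) p →L[ℝ] TangentSpace 𝓘(ℝ, E4) p)
    (e : OpenPartialHomeomorph M E4) : Prop where
  mem : e ∈ IsManifold.maximalAtlas 𝓘(ℝ, E4) ∞ M
  map_J : ∀ q ∈ e.source, ∀ v : E4, chartDeriv e q (J q v) = stdJ (chartDeriv e q v)

lemma IsHolomorphicChart.J_chartDerivSymm (h : IsHolomorphicChart J e) (hp : p ∈ e.source)
    (v : E4) :
    (J p (chartDerivSymm e p v) : E4) = chartDerivSymm e p (stdJ v) := by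
  have h1 := h.map_J p hp (chartDerivSymm e p v)
  rw [chartDeriv_chartDerivSymm h.mem hp] at h1
  rw [← h1]
  exact (chartDerivSymm_chartDeriv h.mem hp _).symm

variable [IsManifold 𝓘(ℝ, E4) ∞ M] (g : Metric M)

/-- The metric at `p`. -/
noncomputable def metricAt (g : Metric M) (p : M) : E4 →L[ℝ] E4 →L[ℝ] ℝ := g.inner p

/-- The coordinate field is the tangent map of the inverse chart applied to a constant field. -/
lemma contMDiffAt_coordVec (he : e ∈ IsManifold.maximalAtlas 𝓘(ℝ, E4) ∞ M) (i : Fin 4) {y : E4}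
    (hy : y ∈ e.target) :
    ContMDiffAt 𝓘(ℝ, E4) (𝓘(ℝ, E4).prod 𝓘(ℝ, E4)) ∞
      (fun z => (⟨e.symm z, coordVec e i z⟩ : TangentBundle 𝓘(ℝ, E4) M)) y := by
  have h1 := (contMDiffOn_symm_of_mem_maximalAtlas he).contMDiffOn_tangentMapWithin (m := ∞)
    (by simp) e.open_target.uniqueMDiffOn
  have h2 : ContMDiff 𝓘(ℝ, E4) (𝓘(ℝ, E4).prod 𝓘(ℝ, E4)) ∞
      (fun z : E4 => (⟨z, (EuclideanSpace.single i (1 : ℝ) : E4)⟩ : TangentBundle 𝓘(ℝ, E4) E4)) :=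
    contMDiff_vectorSpace_iff_contDiff.2 contDiff_const
  have h3 := h1.comp h2.contMDiffOn (s := e.target) (fun z hz => hz)
  refine ((h3 y hy).contMDiffAt (e.open_target.mem_nhds hy)).congr_of_eventuallyEq ?_
  filter_upwards [e.open_target.mem_nhds hy] with z hz
  simp only [Function.comp, tangentMapWithin, coordVec]
  rw [mfderivWithin_of_isOpen e.open_target hz]

lemma smoothMat_metricMatrix (he : e ∈ IsManifold.maximalAtlas 𝓘(ℝ, E4) ∞ M) :
    SmoothMat e.target (metricMatrix g e) := by
  intro i j y hy
  rw [← contMDiffAt_iff_contDiffAt]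
  have hb : ContMDiffAt 𝓘(ℝ, E4) 𝓘(ℝ, E4) ∞ e.symm y :=
    contMDiffAt_symm_of_mem_maximalAtlas he hy
  have : ContMDiffAt 𝓘(ℝ, E4) (𝓘(ℝ, E4).prod 𝓘(ℝ)) ∞
      (fun z ↦ Bundle.TotalSpace.mk' ℝ (E := Bundle.Trivial M ℝ) (e.symm z)
        (g.inner (e.symm z) (coordVec e i z) (coordVec e j z))) y := by
    apply ContMDiffAt.clm_bundle_apply₂ (F₁ := E4) (F₂ := E4)
    · exact ContMDiffAt.comp y g.contMDiff.contMDiffAt hb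
    · exact contMDiffAt_coordVec he i hy
    · exact contMDiffAt_coordVec he j hy
  simp only [Bundle.contMDiffAt_totalSpace] at this
  exact this.2

lemma metricMatrix_apply (hp : p ∈ e.source) (i j : Fin 4) :
    metricMatrix g e (e p) i j = metricAt g p (chartDerivSymm e p (EuclideanSpace.single i 1))
      (chartDerivSymm e p (EuclideanSpace.single j 1)) := by
  have : metricMatrix g e (e p) i j
      = metricAt g (e.symm (e p)) (chartDerivSymm e p (EuclideanSpace.single i 1))
      (chartDerivSymm e p (EuclideanSpace.single j 1)) := rfl
  rw [this, e.left_inv hp]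

/-- The metric in terms of its matrix. -/
lemma metricAt_chartDerivSymm (hp : p ∈ e.source) (u v : E4) :
    metricAt g p (chartDerivSymm e p u) (chartDerivSymm e p v)
      = u.ofLp ⬝ᵥ (metricMatrix g e (e p)).mulVec v.ofLp := by
  rw [apply_map_map_eq_dotProduct]
  congr 2
  ext i j
  exact (metricMatrix_apply g hp i j).symm

lemma metricAt_eq_dotProduct (he : e ∈ IsManifold.maximalAtlas 𝓘(ℝ, E4) ∞ M) (hp : p ∈ e.source)
    (u v : E4) :
    metricAt g p u v = (chartDeriv e p u).ofLp ⬝ᵥ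
      (metricMatrix g e (e p)).mulVec (chartDeriv e p v).ofLp := by
  rw [← metricAt_chartDerivSymm g hp, chartDerivSymm_chartDeriv he hp,
    chartDerivSymm_chartDeriv he hp]

lemma isLocalMetric_metricMatrix (he : e ∈ IsManifold.maximalAtlas 𝓘(ℝ, E4) ∞ M) :
    IsLocalMetric e.target (metricMatrix g e) where
  isOpen := e.open_target
  smooth := smoothMat_metricMatrix g he
  symm y _ := by
    ext i j
    exact g.symm _ _ _
  pos y hy u hu := by
    have hp := e.map_target hy
    have h1 := metricAt_chartDerivSymm g hp (WithLp.toLp 2 u) (WithLp.toLp 2 u)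
    rw [e.right_inv hy] at h1
    change 0 < (WithLp.toLp 2 u).ofLp ⬝ᵥ (metricMatrix g e y).mulVec (WithLp.toLp 2 u).ofLp
    rw [← h1]
    refine g.pos _ _ fun h0 => hu ?_
    have h2 : chartDerivSymm e (e.symm y) (WithLp.toLp 2 u) = 0 := h0
    have h3 := chartDeriv_chartDerivSymm he hp (WithLp.toLp 2 u)
    rw [h2, map_zero] at h3
    simpa using congrArg WithLp.ofLp h3.symm

/-- The transformation law of the metric. -/
lemma metricMatrix_transition (he : e ∈ IsManifold.maximalAtlas 𝓘(ℝ, E4) ∞ M)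
    (he' : e' ∈ IsManifold.maximalAtlas 𝓘(ℝ, E4) ∞ M) {y : E4} (hy : y ∈ e.target)
    (hy' : e.symm y ∈ e'.source) :
    metricMatrix g e y = (jacMat (e' ∘ e.symm) y).transpose
      * metricMatrix g e' ((e' ∘ e.symm) y) * jacMat (e' ∘ e.symm) y := by
  have hp := e.map_target hy
  have hd : DifferentiableAt ℝ (e' ∘ e.symm) y :=
    (contDiffAt_transition he he' hy hy').differentiableAt (by simp)
  have hcol : ∀ i, (chartDeriv e' (e.symm y) (chartDerivSymm e (e.symm y)
      (EuclideanSpace.single i 1))).ofLp = fun a => jacMat (e' ∘ e.symm) y a i := by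
    intro i
    funext a
    rw [jacMat_apply hd, ← fderiv_transition he he' hp hy', chartDeriv_chartDerivSymm he hp,
      e.right_inv hy]
  ext i j
  conv_lhs => rw [← e.right_inv hy]
  rw [metricMatrix_apply g hp, metricAt_eq_dotProduct g he' hy', hcol, hcol, mul_assoc,
    Matrix.mul_apply]
  simp only [dotProduct, Matrix.transpose_apply]
  rfl

variable {g} {f : M → ℝ} {lam : ℝ}

lemma IsKahlerGradientRicciSoliton.ricciMat_add_hessMat
    (hsol : IsKahlerGradientRicciSoliton g J f lam)
    (he : e ∈ IsManifold.maximalAtlas 𝓘(ℝ, E4) ∞ M) {y : E4} (hy : y ∈ e.target) :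
    ricciMat (metricMatrix g e) y + hessMat (metricMatrix g e) (f ∘ e.symm) y
      = lam • metricMatrix g e y := by
  ext i j
  exact hsol.soliton e he y hy i j

/-- The scalar curvature can be computed in any chart. -/
lemma IsKahlerGradientRicciSoliton.scalarCurvature_symm
    (hsol : IsKahlerGradientRicciSoliton g J f lam)
    (he : e ∈ IsManifold.maximalAtlas 𝓘(ℝ, E4) ∞ M) {y : E4} (hy : y ∈ e.target) :
    scalarCurvature g (e.symm y) = coordScalar (metricMatrix g e) y := by
  set e' := chartAt E4 (e.symm y) with he'_def
  have he' : e' ∈ IsManifold.maximalAtlas 𝓘(ℝ, E4) ∞ M := IsManifold.chart_mem_maximalAtlas _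
  have hp' : e.symm y ∈ e'.source := mem_chart_source _ _
  -- The overlap of the two charts, on which the metric matrices and the two expressions of f are
  -- related by the transition map.
  set U := e.target ∩ e.symm ⁻¹' e'.source with hU
  have hUo : IsOpen U := e.isOpen_inter_preimage_symm e'.open_source
  have hm := isLocalMetric_metricMatrix g he
  have hmU : IsLocalMetric U (metricMatrix g e) :=
    ⟨hUo, fun a b z hz => hm.smooth a b z hz.1, fun z hz => hm.symm z hz.1,
      fun z hz => hm.pos z hz.1⟩
  have hyU : y ∈ U := ⟨hy, hp'⟩
  have hinv := trace_covMat_gradVec_comp hmU (isLocalMetric_metricMatrix g he')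
    (smoothFun_comp_symm hsol.smooth_potential he') (τ := e' ∘ e.symm)
    (fun z hz => contDiffAt_transition he he' hz.1 hz.2) (fun z hz => e'.map_source hz.2)
    (fun z hz => metricMatrix_transition g he he' hz.1 hz.2) hyU
  have hcongr : ∀ z ∈ U, (f ∘ e'.symm) ((e' ∘ e.symm) z) = (f ∘ e.symm) z := fun z hz => by
    simp only [Function.comp]
    rw [e'.left_inv hz.2]
  rw [covMat_congr hUo (fun z hz => gradVec_congr hUo hcongr hz) hyU] at hinv
  have e1 : scalarCurvature g (e.symm y) = coordScalar (metricMatrix g e') ((e' ∘ e.symm) y) := rfl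
  -- In both charts S = 4λ - Δf, so invariance of the Laplacian suffices.
  rw [e1, coordScalar_eq hm (smoothFun_comp_symm hsol.smooth_potential he)
    (hsol.ricciMat_add_hessMat he hy) hy, hinv]
  exact coordScalar_eq (isLocalMetric_metricMatrix g he')
    (smoothFun_comp_symm hsol.smooth_potential he')
    (hsol.ricciMat_add_hessMat he' (e'.map_source hp')) (e'.map_source hp')

/-! ### Holomorphic charts -/

/-- The matrix of `stdJ`. -/
def stdJMat : Mat4 := !![0, -1, 0, 0; 1, 0, 0, 0; 0, 0, 0, -1; 0, 0, 1, 0]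

lemma stdJ_ofLp (v : E4) : (stdJ v).ofLp = stdJMat.mulVec v.ofLp := by
  ext i
  fin_cases i <;> simp [stdJ, stdJMat, Matrix.mulVec, dotProduct, Fin.sum_univ_four]

lemma stdJMat_sq : stdJMat * stdJMat = -1 := by
  ext i j
  fin_cases i <;> fin_cases j <;> simp [stdJMat, Matrix.mul_apply, Fin.sum_univ_four]

namespace IsHolomorphicChart

lemma kahlerForm_chartDerivSymm (h : IsHolomorphicChart J e) (hp : p ∈ e.source) (u v : E4) :
    kahlerForm g J p (chartDerivSymm e p u) (chartDerivSymm e p v)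
      = u.ofLp ⬝ᵥ (metricMatrix g e (e p) * stdJMat).mulVec v.ofLp := by
  have h1 : kahlerForm g J p (chartDerivSymm e p u) (chartDerivSymm e p v)
      = metricAt g p (chartDerivSymm e p u) (J p (chartDerivSymm e p v)) := rfl
  rw [h1, h.J_chartDerivSymm hp, metricAt_chartDerivSymm g hp, stdJ_ofLp, Matrix.mulVec_mulVec]

lemma kahlerCoeff_eq (h : IsHolomorphicChart J e) {y : E4} (hy : y ∈ e.target) (i j : Fin 4) :
    kahlerCoeff g J e i j y = (metricMatrix g e y * stdJMat) i j := by
  have h1 := h.kahlerForm_chartDerivSymm (g := g) (e.map_target hy) (EuclideanSpace.single i 1)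
    (EuclideanSpace.single j 1)
  rw [chartDerivSymm, e.right_inv hy] at h1
  refine Eq.trans h1 ?_
  simp

lemma isLocalKahler (h : IsHolomorphicChart J e) (hK : IsKahler g J) :
    IsLocalKahler e.target (metricMatrix g e) stdJMat where
  toIsLocalMetric := isLocalMetric_metricMatrix g h.mem
  sq := stdJMat_sq
  hermitian y hy := by
    have hp := e.map_target hy
    ext i j
    have h1 : metricAt g (e.symm y) (J (e.symm y) (chartDerivSymm e (e.symm y)
        (EuclideanSpace.single i 1))) (J (e.symm y) (chartDerivSymm e (e.symm y)
        (EuclideanSpace.single j 1))) = metricAt g (e.symm y) (chartDerivSymm e (e.symm y)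
        (EuclideanSpace.single i 1)) (chartDerivSymm e (e.symm y)
        (EuclideanSpace.single j 1)) := hK.hermitian _ _ _
    rw [h.J_chartDerivSymm hp, h.J_chartDerivSymm hp, metricAt_chartDerivSymm g hp,
      ← metricMatrix_apply g hp, e.right_inv hy, stdJ_ofLp, stdJ_ofLp] at h1
    rw [← h1, Matrix.mulVec_mulVec, mul_assoc]
    simp [dotProduct, Matrix.mul_apply, Matrix.mulVec]
  closed y hy i j k := by
    have hs := smoothMat_metricMatrix g h.mem
    have key : ∀ i j k, pd i (kahlerCoeff g J e j k) y
        = (matPd i (metricMatrix g e) y * stdJMat) j k := by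
      intro i j k
      rw [pd_congr e.open_target (fun z hz => h.kahlerCoeff_eq hz j k) i hy]
      have := matPd_mul hs (SmoothMat.const stdJMat) i hy
      rw [matPd_const, mul_zero, add_zero] at this
      rw [← this]
      rfl
    rw [← key, ← key, ← key]
    exact hK.closed e h.mem y hy i j k

lemma isLocalSoliton (h : IsHolomorphicChart J e) (hsol : IsKahlerGradientRicciSoliton g J f lam) :
    IsLocalSoliton e.target (metricMatrix g e) stdJMat (f ∘ e.symm) lam where
  toIsLocalKahler := h.isLocalKahler hsol.kahler
  smooth_potential := smoothFun_comp_symm hsol.smooth_potential h.mem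
  soliton _ hy := hsol.ricciMat_add_hessMat h.mem hy

end IsHolomorphicChart

lemma IsKahler.exists_isHolomorphicChart (hK : IsKahler g J) (p : M) :
    ∃ e, IsHolomorphicChart J e ∧ p ∈ e.source := by
  obtain ⟨e, he, hp, hJ⟩ := hK.integrable p
  exact ⟨e, ⟨he, hJ⟩, hp⟩

end Charts

/-! ### Second derivatives at critical points -/

lemma fderiv_eq_zero_iff_pd {φ : E4 → ℝ} {y : E4} : fderiv ℝ φ y = 0 ↔ ∀ i, pd i φ y = 0 := by
  constructor
  · intro h i
    simp [pd, h]
  · intro h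
    ext u
    simp [fderiv_apply_eq_sum_pd, h]

lemma fderiv_fderiv_apply {φ : E4 → ℝ} {y : E4} (h : ContDiffAt ℝ ∞ φ y) (u : E4) (j : Fin 4) :
    fderiv ℝ (fderiv ℝ φ) y u (EuclideanSpace.single j 1) = ∑ i, u i * pd i (pd j φ) y := by
  have hd : DifferentiableAt ℝ (fderiv ℝ φ) y :=
    (h.fderiv_right (m := ∞) (by simp)).differentiableAt (by simp)
  rw [← fderiv_apply_eq_sum_pd]
  change _ = fderiv ℝ (fun z => fderiv ℝ φ z (EuclideanSpace.single j 1)) y u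
  rw [fderiv_clm_apply hd (differentiableAt_const _)]
  simp

/-- At a critical point the Christoffel term of the Hessian vanishes, so the plain second derivative
has matrix GH, and G is invertible. -/
lemma IsLocalMetric.eq_zero_of_fderiv_fderiv {U : Set E4} {G : E4 → Mat4} {φ : E4 → ℝ} {y : E4}
    (h : IsLocalMetric U G) (hφ : SmoothFun U φ) (hy : y ∈ U) (h0 : gradVec G φ y = 0)
    (hH : ∀ x : Fin 4 → ℝ, (covMat G (gradVec G φ) y).mulVec x = 0 → x = 0) {u : E4}
    (hu : ∀ v, fderiv ℝ (fderiv ℝ φ) y u v = 0) : u = 0 := by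
  have h1 : (hessMat G φ y).mulVec u.ofLp = 0 := by
    ext j
    have e1 := hu (EuclideanSpace.single j 1)
    rw [fderiv_fderiv_apply (hφ y hy)] at e1
    rw [← h.hessMat_transpose hφ hy, Pi.zero_apply, ← e1]
    simp only [Matrix.mulVec, dotProduct, Matrix.transpose_apply, hessMat, Matrix.of_apply,
      coordHess, (h.gradVec_eq_zero_iff hy).1 h0, mul_zero, Finset.sum_const_zero, sub_zero]
    exact Finset.sum_congr rfl fun i _ => mul_comm _ _
  rw [← h.mul_covMat_gradVec hφ hy, ← Matrix.mulVec_mulVec] at h1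
  have h2 := congrArg ((G y)⁻¹).mulVec h1
  rw [Matrix.mulVec_mulVec, h.inv_mul hy, Matrix.one_mulVec, Matrix.mulVec_zero] at h2
  have h3 := hH _ h2
  ext i
  exact congrFun h3 i

/-- At a critical point the second derivative is a tensor. -/
lemma fderiv_fderiv_comp {φ : E4 → ℝ} {τ : E4 → E4} {y : E4} (hφ : ContDiffAt ℝ ∞ φ (τ y))
    (hτ : ContDiffAt ℝ ∞ τ y) (h0 : fderiv ℝ φ (τ y) = 0) (u v : E4) :
    fderiv ℝ (fderiv ℝ (φ ∘ τ)) y u v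
      = fderiv ℝ (fderiv ℝ φ) (τ y) (fderiv ℝ τ y u) (fderiv ℝ τ y v) := by
  have dτ : DifferentiableAt ℝ τ y := hτ.differentiableAt (by simp)
  have dφ' : DifferentiableAt ℝ (fderiv ℝ φ) (τ y) :=
    (hφ.fderiv_right (m := ∞) (by simp)).differentiableAt (by simp)
  have dτ' : DifferentiableAt ℝ (fderiv ℝ τ) y :=
    (hτ.fderiv_right (m := ∞) (by simp)).differentiableAt (by simp)
  have ev : fderiv ℝ (φ ∘ τ) =ᶠ[𝓝 y] fun z => (fderiv ℝ φ (τ z)).comp (fderiv ℝ τ z) := by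
    have e1 : ∀ᶠ z in 𝓝 y, DifferentiableAt ℝ τ z :=
      ((hτ.of_le (m := 1) (by simp)).eventually (by simp)).mono
          fun z hz => hz.differentiableAt one_ne_zero
    have e2 : ∀ᶠ z in 𝓝 y, DifferentiableAt ℝ φ (τ z) :=
      dτ.continuousAt.eventually
        (((hφ.of_le (m := 1) (by simp)).eventually (by simp)).mono
          fun z hz => hz.differentiableAt one_ne_zero)
    filter_upwards [e1, e2] with z h1 h2
    exact fderiv_comp z h2 h1
  have hd : HasFDerivAt (fun z => fderiv ℝ φ (τ z))
      ((fderiv ℝ (fderiv ℝ φ) (τ y)).comp (fderiv ℝ τ y)) y :=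
    dφ'.hasFDerivAt.comp y dτ.hasFDerivAt
  -- The term with the second derivative of τ is multiplied by dφ, which is zero at this point.
  rw [ev.fderiv_eq, (hd.clm_comp dτ'.hasFDerivAt).fderiv]
  simp [h0]

/-! ### Singular points of rank zero of the soliton system -/

section Charts

variable {M : Type*} [TopologicalSpace M] [ChartedSpace E4 M]
  {e : OpenPartialHomeomorph M E4} {p : M}

/-- The components of tangent vectors in a chart. -/
noncomputable def chartCoord (he : e ∈ IsManifold.maximalAtlas 𝓘(ℝ, E4) ∞ M)
    (hp : p ∈ e.source) : TangentSpace 𝓘(ℝ, E4) p ≃ₗ[ℝ] (Fin 4 → ℝ) where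
  toFun v := (chartDeriv e p v).ofLp
  invFun x := chartDerivSymm e p (WithLp.toLp 2 x)
  map_add' u v := congrArg WithLp.ofLp (map_add (chartDeriv e p) u v)
  map_smul' c v := congrArg WithLp.ofLp (map_smul (chartDeriv e p) c v)
  left_inv v := chartDerivSymm_chartDeriv he hp v
  right_inv x := congrArg WithLp.ofLp (chartDeriv_chartDerivSymm he hp (WithLp.toLp 2 x))

variable [IsManifold 𝓘(ℝ, E4) ∞ M] {g : Metric M}
  {J : ∀ p : M, TangentSpace 𝓘(ℝ, E4) p →L[ℝ] TangentSpace 𝓘(ℝ, E4) p}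
  {f : M → ℝ} {lam : ℝ}

/-- By chart independence, S near p is the coordinate expression in one fixed holomorphic chart,
where it is smooth. -/
lemma IsKahlerGradientRicciSoliton.mdifferentiableAt_scalarCurvature
    (hsol : IsKahlerGradientRicciSoliton g J f lam) (p : M) :
    MDifferentiableAt 𝓘(ℝ, E4) 𝓘(ℝ, ℝ) (scalarCurvature g) p := by
  obtain ⟨e, he, hp⟩ := hsol.kahler.exists_isHolomorphicChart p
  have h1 : MDifferentiableAt 𝓘(ℝ, E4) 𝓘(ℝ, ℝ) (coordScalar (metricMatrix g e) ∘ e) p :=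
    (((he.isLocalSoliton hsol).smooth_coordScalar.differentiableAt
      (e.map_source hp)).mdifferentiableAt).comp p
        ((chart_mdifferentiable he.mem).mdifferentiableAt hp)
  refine h1.congr_of_eventuallyEq ?_
  filter_upwards [e.open_source.mem_nhds hp] with q hq
  rw [Function.comp, ← hsol.scalarCurvature_symm he.mem (e.map_source hq), e.left_inv hq]

lemma IsKahlerGradientRicciSoliton.mdifferentiableAt_potential
    (hsol : IsKahlerGradientRicciSoliton g J f lam) (p : M) :
    MDifferentiableAt 𝓘(ℝ, E4) 𝓘(ℝ, ℝ) f p :=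
  hsol.smooth_potential.mdifferentiable (by simp) p

namespace IsHolomorphicChart

lemma pd_scalarCurvature (h : IsHolomorphicChart J e)
    (hsol : IsKahlerGradientRicciSoliton g J f lam) {y : E4} (hy : y ∈ e.target) (i : Fin 4) :
    pd i (scalarCurvature g ∘ e.symm) y = pd i (coordScalar (metricMatrix g e)) y :=
  pd_congr e.open_target (fun _ hz => hsol.scalarCurvature_symm h.mem hz) i hy

/-- The singular points of rank zero are the critical points of the potential. -/
lemma mem_singularSet_zero_iff (h : IsHolomorphicChart J e)
    (hsol : IsKahlerGradientRicciSoliton g J f lam) (hp : p ∈ e.source) :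
    p ∈ singularSet f (scalarCurvature g) 0
      ↔ gradVec (metricMatrix g e) (f ∘ e.symm) (e p) = 0 := by
  have hs := h.isLocalSoliton hsol
  have hy := e.map_source hp
  have hmd : MDifferentiableAt 𝓘(ℝ, E4) 𝓘(ℝ, ℝ × ℝ) (fun q => (f q, scalarCurvature g q)) p :=
    (hsol.mdifferentiableAt_potential p).prodMk_space (hsol.mdifferentiableAt_scalarCurvature p)
  have d1 : DifferentiableAt ℝ (f ∘ e.symm) (e p) := hs.smooth_potential.differentiableAt hy
  have d2 : DifferentiableAt ℝ (scalarCurvature g ∘ e.symm) (e p) :=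
    (hs.smooth_coordScalar.congr e.open_target
      (fun _ hz => hsol.scalarCurvature_symm h.mem hz)).differentiableAt hy
  have hpair : ∀ w : E4, fderiv ℝ ((fun q => (f q, scalarCurvature g q)) ∘ e.symm) (e p) w
      = (fderiv ℝ (f ∘ e.symm) (e p) w, fderiv ℝ (scalarCurvature g ∘ e.symm) (e p) w) := by
    intro w
    have := (d1.hasFDerivAt.prodMk d2.hasFDerivAt).fderiv
    exact DFunLike.congr_fun this w
  have hrank : p ∈ singularSet f (scalarCurvature g) 0 ↔ ∀ u : E4,
      (mfderiv 𝓘(ℝ, E4) 𝓘(ℝ, ℝ × ℝ) (fun q => (f q, scalarCurvature g q)) p : E4 →L[ℝ] ℝ × ℝ) u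
        = 0 := by
    simp only [singularSet, Set.mem_ofPred_eq, momentRank, Nat.ofNat_pos, and_true]
    have : Module.Finite ℝ (TangentSpace 𝓘(ℝ, ℝ × ℝ) (f p, scalarCurvature g p)) :=
      inferInstanceAs (Module.Finite ℝ (ℝ × ℝ))
    rw [Submodule.finrank_eq_zero, LinearMap.range_eq_bot]
    exact LinearMap.ext_iff
  rw [hrank, hs.gradVec_eq_zero_iff hy, ← fderiv_eq_zero_iff_pd]
  constructor
  · intro h0
    ext w
    have h1 := h0 (chartDerivSymm e p w)
    rw [mfderiv_eq_fderiv_comp h.mem hp hmd, chartDeriv_chartDerivSymm h.mem hp, hpair] at h1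
    exact (Prod.mk.inj h1).1
  · intro h0 u
    have h1 : fderiv ℝ (scalarCurvature g ∘ e.symm) (e p) = 0 := by
      rw [fderiv_eq_zero_iff_pd]
      intro i
      rw [h.pd_scalarCurvature hsol hy]
      exact hs.pd_coordScalar_eq_zero hy
        ((hs.gradVec_eq_zero_iff hy).2 (fderiv_eq_zero_iff_pd.1 h0)) i
    rw [mfderiv_eq_fderiv_comp h.mem hp hmd, hpair, h0, h1]
    rfl

/-- Hamiltonian vector fields in a holomorphic chart. -/
lemma chartField_eq (h : IsHolomorphicChart J e) (hsol : IsKahlerGradientRicciSoliton g J f lam)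
    {a b : ℝ} {X : ∀ p : M, TangentSpace 𝓘(ℝ, E4) p}
    (hX : IsHamiltonianField (kahlerForm g J) (fun q => a * f q + b * scalarCurvature g q) X)
    {y : E4} (hy : y ∈ e.target) :
    (chartField X e y).ofLp = hamField (metricMatrix g e) stdJMat (f ∘ e.symm) a b y := by
  have hs := h.isLocalSoliton hsol
  have hp := e.map_target hy
  set ψ : E4 → ℝ := fun z => a * (f ∘ e.symm) z + b * coordScalar (metricMatrix g e) z with hψ
  set x : Fin 4 → ℝ := (chartField X e y).ofLp with hx
  have hXp : chartDerivSymm e (e.symm y) (chartField X e y) = X (e.symm y) :=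
    chartDerivSymm_chartDeriv h.mem hp _
  have hmd : MDifferentiableAt 𝓘(ℝ, E4) 𝓘(ℝ, ℝ) (fun q => a * f q + b * scalarCurvature g q)
      (e.symm y) :=
    ((hsol.mdifferentiableAt_potential _).const_smul a).add
      ((hsol.mdifferentiableAt_scalarCurvature _).const_smul b)
  have h1 : ((metricMatrix g e y * stdJMat).transpose).mulVec x = fun j => pd j ψ y := by
    funext j
    have e1 := hX (e.symm y) (chartDerivSymm e (e.symm y) (EuclideanSpace.single j 1))
    have e2 := mfderiv_eq_fderiv_comp h.mem hp hmd
      (chartDerivSymm e (e.symm y) (EuclideanSpace.single j 1))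
    rw [chartDeriv_chartDerivSymm h.mem hp, e.right_inv hy] at e2
    have e3 := h.kahlerForm_chartDerivSymm (g := g) hp (chartField X e y)
      (EuclideanSpace.single j 1)
    rw [hXp, e.right_inv hy] at e3
    have e4 : pd j ((fun q => a * f q + b * scalarCurvature g q) ∘ e.symm) y = pd j ψ y :=
      pd_congr e.open_target (fun z hz => by
        simp only [hψ, Function.comp, hsol.scalarCurvature_symm h.mem hz]) j hy
    rw [← e4]
    refine Eq.trans ?_ ((e3.symm.trans e1).trans e2)
    rw [Matrix.mulVec_transpose]
    simp [Matrix.vecMul, hx]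
    rfl
  -- Skewness of ω turns ι_X ω = dh into -GJX = dh. Cancelling G and applying J gives X = J∇h.
  have h2 : (metricMatrix g e y * stdJMat).transpose = -(metricMatrix g e y * stdJMat) := by
    rw [Matrix.transpose_mul, hs.symm y hy, hs.transpose_mul hy]
  rw [h2, ← hs.mulVec_gradVec hy, Matrix.neg_mulVec, ← Matrix.mulVec_mulVec] at h1
  have h3 := congrArg ((metricMatrix g e y)⁻¹).mulVec h1
  have hinv : ∀ z, ((metricMatrix g e y)⁻¹).mulVec ((metricMatrix g e y).mulVec z)
      = z := fun z => by
    rw [Matrix.mulVec_mulVec, hs.inv_mul hy, Matrix.one_mulVec]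
  rw [Matrix.mulVec_neg, hinv, hinv] at h3
  rw [hamField, ← h3, Matrix.mulVec_neg, Matrix.mulVec_mulVec, hs.sq, Matrix.neg_mulVec,
    Matrix.one_mulVec, neg_neg]

/-- The linearizations at a critical point in a holomorphic chart. -/
lemma chartCoord_linearization (h : IsHolomorphicChart J e)
    (hsol : IsKahlerGradientRicciSoliton g J f lam) (hp : p ∈ e.source)
    (h0 : gradVec (metricMatrix g e) (f ∘ e.symm) (e p) = 0)
    {A : Module.End ℝ (TangentSpace 𝓘(ℝ, E4) p)}
    (hA : A ∈ linearizedOperators (kahlerForm g J) f (scalarCurvature g) p) :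
    ∃ a b : ℝ, ∀ v, chartCoord h.mem hp (A v) = (stdJMat * (a • 1 + b • (lam • 1
      - covMat (metricMatrix g e) (gradVec (metricMatrix g e) (f ∘ e.symm)) (e p)))
      * covMat (metricMatrix g e) (gradVec (metricMatrix g e) (f ∘ e.symm)) (e p)).mulVec
        (chartCoord h.mem hp v) := by
  have hs := h.isLocalSoliton hsol
  have hy := e.map_source hp
  obtain ⟨a, b, X, hX, -, hlin⟩ := hA
  obtain ⟨D, hD, hDA⟩ := hlin e h.mem hp
  -- The factor 2 comes from ∇S = 2(λ - H)∇f and is absorbed into the second coefficient.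
  refine ⟨a, 2 * b, fun v => ?_⟩
  have e1 : chartCoord h.mem hp (A v) = (D (chartDeriv e p v)).ofLp :=
    congrArg WithLp.ofLp (hDA v)
  rw [e1]
  funext l
  have e2 : HasFDerivAt (fun z => chartField X e z l) ((EuclideanSpace.proj l).comp D) (e p) :=
    (EuclideanSpace.proj (𝕜 := ℝ) l).hasFDerivAt.comp (e p) hD
  have e3 : (D (chartDeriv e p v)).ofLp l
      = fderiv ℝ (fun z => chartField X e z l) (e p) (chartDeriv e p v) := by
    rw [e2.fderiv]; rfl
  rw [e3, fderiv_apply_eq_sum_pd]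
  simp only [Matrix.mulVec, dotProduct]
  refine Finset.sum_congr rfl fun i _ => ?_
  rw [← hs.vecPd_hamField hy h0, mul_comm]
  exact congrArg (· * _)
    (pd_congr e.open_target (fun z hz => congrFun (h.chartField_eq hsol hX hz) l) i hy)

/-- A non-degenerate singular point of rank zero is of elliptic-elliptic type, and the Hessian of
the potential is non-degenerate there. -/
lemma injective_and_isEllipticElliptic (h : IsHolomorphicChart J e)
    (hsol : IsKahlerGradientRicciSoliton g J f lam) (hp : p ∈ e.source)
    (h0 : p ∈ singularSet f (scalarCurvature g) 0)
    (hnd : IsNondegenerateRankZero (kahlerForm g J) f (scalarCurvature g) p) :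
    (∀ x : Fin 4 → ℝ, (covMat (metricMatrix g e) (gradVec (metricMatrix g e) (f ∘ e.symm))
      (e p)).mulVec x = 0 → x = 0) ∧
    IsEllipticElliptic (kahlerForm g J) f (scalarCurvature g) p := by
  have hs := h.isLocalSoliton hsol
  have hy := e.map_source hp
  rw [h.mem_singularSet_zero_iff hsol hp] at h0
  set H := covMat (metricMatrix g e) (gradVec (metricMatrix g e) (f ∘ e.symm)) (e p) with hH
  set c := chartCoord h.mem hp with hc
  let B : LinearMap.BilinForm ℝ (TangentSpace 𝓘(ℝ, E4) p) :=
    LinearMap.mk₂ ℝ (fun u v => g.inner p u v)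
      (by intros; simp) (by intros; simp) (by intros; simp) (by intros; simp)
  have hB : ∀ u v, B u v = c u ⬝ᵥ (metricMatrix g e (e p)).mulVec (c v) := fun u v =>
    metricAt_eq_dotProduct g h.mem hp u v
  -- The Hessian endomorphism carried from coordinates to the tangent space, where the algebra K
  -- lives.
  let Hm : Module.End ℝ (TangentSpace 𝓘(ℝ, E4) p) :=
    c.symm.toLinearMap ∘ₗ Matrix.toLin' H ∘ₗ c.toLinearMap
  have hHm : ∀ v, c (Hm v) = H.mulVec (c v) := fun v => by simp [Hm]
  have hJ : ∀ v, c (J p v) = stdJMat.mulVec (c v) := fun v =>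
    (congrArg WithLp.ofLp (h.map_J p hp v)).trans (stdJ_ofLp _)
  have hpair : IsHermitianPair B (J p).toLinearMap :=
    { symm := fun u v => g.symm p u v
      pos := fun u hu => g.pos p u hu
      sq := fun u => hsol.kahler.sq p u
      hermitian := fun u v => hsol.kahler.hermitian p u v }
  have hrank : Module.finrank ℝ (TangentSpace 𝓘(ℝ, E4) p) = 4 := by
    rw [c.finrank_eq]; simp
  have key := injective_and_hasType_of_isCartanSubalgebra (H := Hm) (lam := lam)
    (S := linearizedOperators (kahlerForm g J) f (scalarCurvature g) p) hrank hpair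
    (Ω := kahlerForm g J p) (fun u v => rfl)
    (fun u v => by
      rw [hB, hB, hHm, hHm, Matrix.mulVec_mulVec, ← hs.transpose_covMat_mul hy,
        ← Matrix.mulVec_mulVec, Matrix.dotProduct_mulVec _ H.transpose, Matrix.vecMul_transpose])
    (fun u => c.injective (by
      change c (Hm (J p u)) = c (J p (Hm u))
      rw [hHm, hJ, hJ, hHm, Matrix.mulVec_mulVec, Matrix.mulVec_mulVec, hs.covMat_mul hy]))
    (fun A hA => by
      obtain ⟨a, b, hab⟩ := h.chartCoord_linearization hsol hp h0 hA
      refine ⟨a, b, LinearMap.ext fun v => c.injective ?_⟩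
      rw [hab]
      change _ = c (J p (a • Hm v + b • (lam • Hm v - Hm (Hm v))))
      rw [hJ]
      simp only [map_add, map_sub, map_smul, hHm, ← Matrix.mulVec_mulVec, Matrix.add_mulVec,
        Matrix.smul_mulVec, Matrix.sub_mulVec, Matrix.one_mulVec]
      rfl)
    hnd
  refine ⟨fun x hx => ?_, key.2⟩
  have h1 : Hm (c.symm x) = 0 := c.injective (by rw [hHm, c.apply_symm_apply, hx, map_zero])
  have h2 := key.1 (h1.trans (map_zero Hm).symm)
  rw [← c.apply_symm_apply x, h2, map_zero]

end IsHolomorphicChart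

end Charts
end KahlerSoliton

/-! ### Isolation of the critical points and the Morse property -/

theorem theorem5p3 {M : Type*} [TopologicalSpace M] [ChartedSpace E4 M]
    [IsManifold 𝓘(ℝ, E4) ∞ M] [T2Space M] [SecondCountableTopology M] [ConnectedSpace M]
    (g : Metric M) (J : ∀ p : M, TangentSpace 𝓘(ℝ, E4) p →L[ℝ] TangentSpace 𝓘(ℝ, E4) p)
    (f : M → ℝ) (lam : ℝ) (hsol : IsKahlerGradientRicciSoliton g J f lam) :
    (∀ m ∈ singularSet f (scalarCurvature g) 0,
      IsNondegenerateRankZero (kahlerForm g J) f (scalarCurvature g) m →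
        (∃ U ∈ 𝓝 m, ∀ p ∈ U, p ∈ singularSet f (scalarCurvature g) 0 → p = m) ∧
        IsEllipticElliptic (kahlerForm g J) f (scalarCurvature g) m) ∧
    (IsNondegenerateSystem (kahlerForm g J) f (scalarCurvature g) → IsMorse f) := by
  constructor
  · intro m hm hnd
    obtain ⟨e, he, hme⟩ := hsol.kahler.exists_isHolomorphicChart m
    have hs := he.isLocalSoliton hsol
    have hy := e.map_source hme
    obtain ⟨hinj, hell⟩ := he.injective_and_isEllipticElliptic hsol hme hm hnd
    refine ⟨?_, hell⟩
    have h0 := (he.mem_singularSet_zero_iff hsol hme).1 hm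
    have hd : DifferentiableAt ℝ (fderiv ℝ (f ∘ e.symm)) (e m) :=
      ((hs.smooth_potential _ hy).fderiv_right (m := ∞) (by simp)).differentiableAt (by simp)
    have hker : LinearMap.ker (fderiv ℝ (fderiv ℝ (f ∘ e.symm)) (e m)).toLinearMap = ⊥ := by
      rw [LinearMap.ker_eq_bot']
      intro u hu
      exact hs.eq_zero_of_fderiv_fderiv hs.smooth_potential hy h0 hinj
        fun v => DFunLike.congr_fun hu v
    -- The map y ↦ df(y) has injective derivative at the critical point, hence bounded below in
    -- finite dimension, so df does not vanish on a punctured neighbourhood.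
    obtain ⟨K, -, hK⟩ := LinearMap.exists_antilipschitzWith _ hker
    have hne := hd.hasFDerivAt.eventually_ne (c := 0)
      ⟨K, hK⟩
    rw [eventually_nhdsWithin_iff] at hne
    refine ⟨_, Filter.inter_mem (e.open_source.mem_nhds hme)
      ((e.continuousAt hme).eventually hne), fun p hp hp0 => ?_⟩
    by_contra hpm
    refine hp.2 (fun h1 => hpm (e.injOn hp.1 hme h1)) ?_
    rw [fderiv_eq_zero_iff_pd, ← hs.gradVec_eq_zero_iff (e.map_source hp.1)]
    exact (he.mem_singularSet_zero_iff hsol hp.1).1 hp0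
  · intro hsys
    refine ⟨hsol.smooth_potential, fun p hp e₁ he₁ hpe₁ u hu => ?_⟩
    obtain ⟨e, he, hpe⟩ := hsol.kahler.exists_isHolomorphicChart p
    have hs := he.isLocalSoliton hsol
    have hy := e.map_source hpe
    have hcrit : fderiv ℝ (f ∘ e.symm) (e p) = 0 := by
      ext w
      have := mfderiv_eq_fderiv_comp he.mem hpe (hsol.mdifferentiableAt_potential p)
        (chartDerivSymm e p w)
      rw [chartDeriv_chartDerivSymm he.mem hpe, hp] at this
      exact this.symm
    have h0 : gradVec (metricMatrix g e) (f ∘ e.symm) (e p) = 0 :=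
      (hs.gradVec_eq_zero_iff hy).2 (fderiv_eq_zero_iff_pd.1 hcrit)
    have hm : p ∈ singularSet f (scalarCurvature g) 0 := (he.mem_singularSet_zero_iff hsol hpe).2 h0
    obtain ⟨hinj, -⟩ := he.injective_and_isEllipticElliptic hsol hpe hm (hsys.1 p hm)
    have hl := e₁.left_inv hpe₁
    -- Non-degeneracy is known in a holomorphic chart, while the Morse condition ranges over all
    -- smooth charts. The Hessian at a critical point is a tensor, so it is transported by the
    -- transition map.
    set τ := e ∘ e₁.symm with hτ
    have hτp : τ (e₁ p) = e p := by rw [hτ, Function.comp, hl]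
    have hy₁ := e₁.map_source hpe₁
    have sτ : ContDiffAt ℝ ∞ τ (e₁ p) :=
      contDiffAt_transition he₁ he.mem hy₁ (by rwa [hl])
    have hev : f ∘ e₁.symm =ᶠ[𝓝 (e₁ p)] (f ∘ e.symm) ∘ τ := by
      filter_upwards [(e₁.isOpen_inter_preimage_symm e.open_source).mem_nhds
        ⟨hy₁, by rwa [Set.mem_preimage, hl]⟩] with z hz
      simp only [hτ, Function.comp]
      rw [e.left_inv hz.2]
    have hT : ∀ w, fderiv ℝ τ (e₁ p) (chartDeriv e₁ p w) = chartDeriv e p w :=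
      fderiv_transition he₁ he.mem hpe₁ hpe
    have hTu : fderiv ℝ τ (e₁ p) u = 0 := by
      refine hs.eq_zero_of_fderiv_fderiv hs.smooth_potential hy h0 hinj fun v => ?_
      have h1 := hu (chartDeriv e₁ p (chartDerivSymm e p v))
      rw [hev.fderiv.fderiv_eq, fderiv_fderiv_comp (by rw [hτp]; exact hs.smooth_potential _ hy) sτ
        (by rw [hτp, hcrit]), hT, chartDeriv_chartDerivSymm he.mem hpe, hτp] at h1
      exact h1
    rw [← chartDeriv_chartDerivSymm he₁ hpe₁ u, hT] at hTu
    have h2 := congrArg (chartDerivSymm e p) hTu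
    rw [chartDerivSymm_chartDeriv he.mem hpe, map_zero] at h2
    rw [← chartDeriv_chartDerivSymm he₁ hpe₁ u, h2, map_zero]
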